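/- All graphs are finite, simple and undirected. For $P\subseteq[0,1]^V$ let $\mathrm{cone}(P)=\{(\lambda,\lambda x):\lambda\ge 0,\ x\in P\}\subseteq\mathbb{R}^{\{0\}\cup V}$, let $P_I=\mathrm{conv}(P\cap\{0,1\}^V)$, and let $\mathrm{LS}_+(P)$ be the set of all $x\in\mathbb{R}^V$ for which there is a real symmetric positive semidefinite matrix $Y$ indexed by $\{0\}\cup V$ with $Ye_0=\mathrm{diag}(Y)=(1,x)$ and $Ye_v,\ Y(e_0-e_v)\in\mathrm{cone}(P)$ for every $v\in V$. Put $\mathrm{LS}_+^0(P)=P$ and $\mathrm{LS}_+^{k+1}(P)=\mathrm{LS}_+(\mathrm{LS}_+^{k}(P))$. The $\mathrm{LS}_+$-rank $r_+(G)$ of a graph $G$ is the smallest $k\ge 0$ with $\mathrm{LS}_+^k(\mathrm{FRAC}(G))=\mathrm{FRAC}(G)_I$, where $\mathrm{FRAC}(G)=\{x\in[0,1]^{V(G)}: x_u+x_v\le 1 \text{ for all } \{u,v\}\in E(G)\}$. For a positive integer $\ell$, a graph $G$ is $\ell$-minimal if $r_+(G)=\ell$ and $|V(G)|=3\ell$,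 and $n_+(\ell)$ is the smallest number of vertices of a graph with $\mathrm{LS}_+$-rank $\ell$. To $2$-stretch a vertex $v$ of a graph $G$, choose (possibly empty) sets $A_1,A_2$ with $A_1\cup A_2$ equal to the neighborhood of $v$, replace $v$ by three vertices $v_0,v_1,v_2$, and join $v_j$ to $v_0$ and to every vertex of $A_j$ for $j=1,2$; the vertices $v_1,v_2$ are called the wings of $v$. For $n\ge 3$ and $d\ge 0$ let $\mathcal{K}_{n,d}$ be the set of graphs obtained (up to isomorphism) from the complete graph $K_n$ by $2$-stretching, one after the other, $d$ of its $n$ vertices, and let $\hat{\mathcal{K}}_{n,d}$ be the set of those graphs in $\mathcal{K}_{n,d}$ in which, for any two distinct stretched vertices $i,j$ of $K_n$, exactly one edge joins a wing of $i$ to a wing of $j$. **Corollary 5.1.** Let $\ell$ be a positive integer. Then every graph $G\in\hat{\mathcal{K}}_{\ell+2,\ell-1}$ with clique number $\omega(G)\le 3$ is $\ell$-minimal, that is, $|V(G)|=3\ell$ and $r_+(G)=\ell$. Moreover, $n_+(\ell)=3\ell$. -/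

import Mathlib

/-- The set obtained by homogenizing `P ⊆ ℝ^V`: all vectors `(λ, λ x)` with `λ ≥ 0` and `x ∈ P`.
The additional coordinate (usually called `0`) is `none : Option V`. -/
def homCone {V : Type*} (P : Set (V → ℝ)) : Set (Option V → ℝ) :=
  {y | ∃ c : ℝ, 0 ≤ c ∧ ∃ x ∈ P, y none = c ∧ ∀ v, y (some v) = c * x v}

/-- The lifted set: positive semidefinite (in particular symmetric) matrices `Y` indexed by
`{0} ∪ V` with `Y e₀ = diag Y` and `Y e_v, Y (e₀ - e_v) ∈ homCone P` for all `v`.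
Here `Y.col a` is the column `Y e_a`. -/
def lsPlusLift {V : Type*} (P : Set (V → ℝ)) : Set (Matrix (Option V) (Option V) ℝ) :=
  {Y | Y.PosSemidef ∧ Y.col none = Y.diag ∧
    ∀ v : V, Y.col (some v) ∈ homCone P ∧ Y.col none - Y.col (some v) ∈ homCone P}

/-- The Lovász–Schrijver operator `LS₊`. -/
def lsPlus {V : Type*} (P : Set (V → ℝ)) : Set (V → ℝ) :=
  {x | ∃ Y ∈ lsPlusLift P, Y none none = 1 ∧ ∀ v, Y (some v) none = x v}

/-- The iterates `LS₊^k`. -/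
def lsPlusIter {V : Type*} (P : Set (V → ℝ)) : ℕ → Set (V → ℝ)
  | 0 => P
  | k + 1 => lsPlus (lsPlusIter P k)

/-- The integer hull: the convex hull of the 0-1 points of `P`. -/
def integerHull {V : Type*} (P : Set (V → ℝ)) : Set (V → ℝ) :=
  convexHull ℝ {x | x ∈ P ∧ ∀ v, x v = 0 ∨ x v = 1}

/-- `P` has `LS₊`-rank `r`: `r` is the smallest `k` with `LS₊^k(P)` equal to the integer hull. -/
def HasLSPlusRank {V : Type*} (P : Set (V → ℝ)) (r : ℕ) : Prop :=
  IsLeast {k : ℕ | lsPlusIter P k = integerHull P} r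

/-- The fractional stable set polytope. -/
def fracStab {V : Type*} (G : SimpleGraph V) : Set (V → ℝ) :=
  {x | (∀ v, 0 ≤ x v ∧ x v ≤ 1) ∧ ∀ u v, G.Adj u v → x u + x v ≤ 1}

/-- The graph `G` has `LS₊`-rank `r`. -/
def GraphHasLSPlusRank {V : Type*} (G : SimpleGraph V) (r : ℕ) : Prop :=
  HasLSPlusRank (fracStab G) r

/-- `G` is `ℓ`-minimal: it has `3ℓ` vertices and `LS₊`-rank `ℓ`. -/
def IsLSMinimal {V : Type*} [Fintype V] (ℓ : ℕ) (G : SimpleGraph V) : Prop :=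
  GraphHasLSPlusRank G ℓ ∧ Fintype.card V = 3 * ℓ

/-- The result of stretching the vertex `v` of `G` along the sets `A 0, …, A (k-1)` of vertices.
The vertex `v` is replaced by `v₀ = inr none` and `v_j = inr (some j)`; each `v_j` is joined to `v₀`
and to all of `A j`. This is a stretching when the sets `A j` have union `G.neighborSet v`. -/
def stretchGraph {V : Type*} (G : SimpleGraph V) (v : V) {k : ℕ} (A : Fin k → Set V) :
    SimpleGraph ({u : V // u ≠ v} ⊕ Option (Fin k)) where
  Adj
    | .inl a, .inl b => G.Adj a b
    | .inl a, .inr (some j) => (a : V) ∈ A j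
    | .inr (some j), .inl a => (a : V) ∈ A j
    | .inr none, .inr (some _) => True
    | .inr (some _), .inr none => True
    | _, _ => False
  symm := ⟨by
    rintro (a | _ | j) (b | _ | j') h
    all_goals first | exact SimpleGraph.Adj.symm h | exact h⟩
  loopless := ⟨by
    rintro (a | _ | j) h
    all_goals first | exact SimpleGraph.irrefl G h | exact h⟩

/-- The names of the vertices of a stretched clique: the unstretched vertex `i`, the hub `i₀` or
the wings `i₁, i₂` of a stretched vertex `i`. -/
inductive StretchName (n : ℕ) : Type
  | unstretched (i : Fin n)
  | hub (i : Fin n)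
  | wing (i : Fin n) (j : Fin 2)

/-- The names after 2-stretching the unstretched vertex `v` with name `i`. -/
def stretchNames {n : ℕ} {V : Type*} (name : V → StretchName n) (v : V) (i : Fin n) :
    {u : V // u ≠ v} ⊕ Option (Fin 2) → StretchName n
  | .inl u => name u
  | .inr none => .hub i
  | .inr (some j) => .wing i j

/-- Graphs (with named vertices) obtained from the complete graph on `n` vertices by 2-stretching,
one after the other, `d` of its `n` vertices. -/
inductive NamedStretchedClique (n : ℕ) :
    (d : ℕ) → (V : Type) → SimpleGraph V → (V → StretchName n) → Prop
  | clique : NamedStretchedClique n 0 (Fin n) ⊤ StretchName.unstretched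
  | stretch {d : ℕ} {V : Type} {G : SimpleGraph V} {name : V → StretchName n}
      (h : NamedStretchedClique n d V G name) (v : V) (i : Fin n)
      (hv : name v = .unstretched i) (A : Fin 2 → Set V)
      (hA : ⋃ j, A j = G.neighborSet v) :
      NamedStretchedClique n (d + 1) ({u : V // u ≠ v} ⊕ Option (Fin 2))
        (stretchGraph G v A) (stretchNames name v i)

/-- The edges joining a wing of `i` to a wing of `j`. -/
def wingEdges {n : ℕ} {V : Type*} (G : SimpleGraph V) (name : V → StretchName n) (i j : Fin n) :
    Set (Sym2 V) :=
  {e | e ∈ G.edgeSet ∧ ∃ x y a b, name x = .wing i a ∧ name y = .wing j b ∧ e = s(x, y)}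

/-- The class `K̂_{n,d}` (closed under isomorphism): `G` arises from `K_n` by 2-stretching `d` of its
vertices so that between the wings of any two distinct stretched vertices there is exactly one
edge. A vertex `i` is stretched when some vertex is the hub of `i`. -/
def IsHatStretchedClique {V : Type*} (n d : ℕ) (G : SimpleGraph V) : Prop :=
  ∃ (W : Type) (H : SimpleGraph W) (name : W → StretchName n),
    NamedStretchedClique n d W H name ∧ Nonempty (G ≃g H) ∧
    ∀ i j : Fin n, i ≠ j → (∃ x, name x = .hub i) → (∃ y, name y = .hub j) →
      (wingEdges H name i j).ncard = 1

/-! Upper bound. `LS₊^k` reaches the integer hull on every graph with at most `3k + 2` vertices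
(`lsPlusIter_eq_integerHull`). A vertex with at most one neighbour in the support can be deleted.
Otherwise every column `Y e_v` with `x_v > 0`, scaled, is supported on `v` and its non-neighbours,
of which at most `n - 3` lie in the support, so induction puts it in the hull. Positive
semidefiniteness passes this from the columns to `Y e₀` (`mem_integerHull_of_columns`). Hence `3ℓ`
vertices give rank at most `ℓ`, and fewer give rank at most `ℓ - 1`.

Lower bound. In a stretched clique with unstretched set `U` and stretched set `D`, stable sets have
at most `|D| + 1` vertices (`card_le_of_indep`); call those attaining this bound tight. Let `p` be
the homogenized indicator vector of the hubs. There are only `|D|` of them, so subtracting `ε p`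
from the sum of the tight vectors `(1, χ_S)` violates the inequality. `HasGap` says that the
resulting vector survives in the cone over `LS₊^k` for some `ε > 0`. The core, `hasGap`, proves this
when `|U| + |D| = k + 3` and there is no `K₄`, by induction on `k` and then on `|D|`.

If some wing sees `U` and a wing of every other stretched vertex, that wing replaces its stretched
vertex, which lowers `|D|`; a linear map cloning coordinates lifts the gap back (`hasGap_of_full`).
If no wing does, then `(|D| + 1) p - e₀` lies in the span of the tight vectors
(`hub_combination_mem_span`). This makes the matrix `∑ χ_S χ_Sᵀ - ε p pᵀ + c e₀ e₀ᵀ`, with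
homogenized `χ_S`, positive semidefinite for suitable small `ε` and `c`. Its columns are controlled
by the gaps of the stretched cliques with one part removed, so its first column is in the next level
(`hasGap_succ`). The induction cannot run into `D = ∅` at a positive level, since `U` would then be
a clique on at least four vertices.

For the existence half, an explicit 3-colourable stretched clique is used. -/

set_option linter.unusedSectionVars false
open Matrix

/-! ### Homogenized cones. -/

section HomCone

variable {V : Type*} {P : Set (V → ℝ)}

theorem homCone_smul {y : Option V → ℝ} (hy : y ∈ homCone P) {a : ℝ} (ha : 0 ≤ a) :
    a • y ∈ homCone P := by
  obtain ⟨c, hc, x, hx, h0, h⟩ := hy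
  refine ⟨a * c, mul_nonneg ha hc, x, hx, by simp [h0], fun v => ?_⟩
  simp [h, mul_assoc]

theorem zero_mem_homCone (h : P.Nonempty) : (0 : Option V → ℝ) ∈ homCone P := by
  obtain ⟨x, hx⟩ := h
  exact ⟨0, le_rfl, x, hx, rfl, by simp⟩

theorem mem_homCone_of_pos {y : Option V → ℝ} (h0 : 0 < y none)
    (h : (fun v => y (some v) / y none) ∈ P) : y ∈ homCone P :=
  ⟨y none, h0.le, _, h, rfl, fun v => by field_simp⟩

theorem div_mem_of_mem_homCone {y : Option V → ℝ} (hy : y ∈ homCone P) (h0 : 0 < y none) :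
    (fun v => y (some v) / y none) ∈ P := by
  obtain ⟨c, hc, x, hx, h1, h2⟩ := hy
  convert hx using 1
  ext v
  rw [h2, ← h1]
  field_simp

theorem homCone_add (hP : Convex ℝ P) {y z : Option V → ℝ} (hy : y ∈ homCone P)
    (hz : z ∈ homCone P) : y + z ∈ homCone P := by
  obtain ⟨a, ha, x, hx, hy0, hy⟩ := hy
  obtain ⟨b, hb, x', hx', hz0, hz⟩ := hz
  rcases (add_nonneg ha hb).eq_or_lt' with h | h
  · have ha' : a = 0 := by linarith
    have hb' : b = 0 := by linarith
    exact ⟨0, le_rfl, x, hx, by simp [hy0, hz0, ha', hb'], fun v => by simp [hy, hz, ha', hb']⟩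
  · refine ⟨a + b, h.le, (a / (a + b)) • x + (b / (a + b)) • x',
      hP hx hx' (by positivity) (by positivity) (by field_simp), by simp [hy0, hz0], fun v => ?_⟩
    simp only [Pi.add_apply, Pi.smul_apply, smul_eq_mul, hy, hz]
    field_simp

theorem homCone_sum (hP : Convex ℝ P) (hne : P.Nonempty) {ι : Type*} (s : Finset ι)
    (y : ι → Option V → ℝ) (h : ∀ i ∈ s, y i ∈ homCone P) : ∑ i ∈ s, y i ∈ homCone P := by
  classical
  induction s using Finset.induction_on with
  | empty => simpa using zero_mem_homCone hne
  | insert i s hi ih =>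
    rw [Finset.sum_insert hi]
    exact homCone_add hP (h i (by simp)) (ih fun j hj => h j (by simp [hj]))

theorem homCone_nonneg (hP : ∀ x ∈ P, ∀ v, 0 ≤ x v) {y : Option V → ℝ} (hy : y ∈ homCone P) (o) :
    0 ≤ y o := by
  obtain ⟨a, ha, x, hx, hy0, hy⟩ := hy
  cases o with
  | none => rwa [hy0]
  | some v => rw [hy]; exact mul_nonneg ha (hP x hx v)

end HomCone

/-! ### The operator `LS₊`: convexity, monotonicity, and coordinate maps. -/

section LsPlus

variable {V : Type*} {P Q : Set (V → ℝ)}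

/-- The homogenization `(1, x)` of a point `x`. -/
def homPoint (x : V → ℝ) : Option V → ℝ := fun o => o.elim 1 x

@[simp] theorem homPoint_none (x : V → ℝ) : homPoint x none = 1 := rfl
@[simp] theorem homPoint_some (x : V → ℝ) (v : V) : homPoint x (some v) = x v := rfl

theorem homPoint_mem_homCone {x : V → ℝ} (hx : x ∈ P) : homPoint x ∈ homCone P :=
  ⟨1, zero_le_one, x, hx, rfl, by simp⟩

theorem mem_of_homPoint_mem_homCone {x : V → ℝ} (hx : homPoint x ∈ homCone P) : x ∈ P := by
  simpa using div_mem_of_mem_homCone hx (by simp)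

theorem lsPlusLift_smul {Y : Matrix (Option V) (Option V) ℝ} (hY : Y ∈ lsPlusLift P) {a : ℝ}
    (ha : 0 ≤ a) : a • Y ∈ lsPlusLift P := by
  refine ⟨hY.1.smul ha, ?_, fun v => ⟨?_, ?_⟩⟩
  · have := congrArg (a • ·) hY.2.1
    ext i
    simpa using congrFun this i
  · exact homCone_smul (hY.2.2 v).1 ha
  · convert homCone_smul (hY.2.2 v).2 ha using 1
    ext i
    simp [mul_sub]

theorem lsPlusLift_add (hP : Convex ℝ P) {Y Z : Matrix (Option V) (Option V) ℝ}
    (hY : Y ∈ lsPlusLift P) (hZ : Z ∈ lsPlusLift P) : Y + Z ∈ lsPlusLift P := by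
  refine ⟨hY.1.add hZ.1, ?_, fun v => ⟨?_, ?_⟩⟩
  · ext i
    have h1 := congrFun hY.2.1 i
    have h2 := congrFun hZ.2.1 i
    simp only [Matrix.col_apply, Matrix.diag_apply] at h1 h2
    simp [h1, h2]
  · exact homCone_add hP (hY.2.2 v).1 (hZ.2.2 v).1
  · convert homCone_add hP (hY.2.2 v).2 (hZ.2.2 v).2 using 1
    ext i
    simp; ring

theorem convex_lsPlus (hP : Convex ℝ P) : Convex ℝ (lsPlus P) := by
  rintro x ⟨Y, hY, hY0, hYx⟩ x' ⟨Z, hZ, hZ0, hZx⟩ a b ha hb hab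
  refine ⟨a • Y + b • Z, lsPlusLift_add hP (lsPlusLift_smul hY ha) (lsPlusLift_smul hZ hb), ?_, ?_⟩
  · simp [hY0, hZ0, hab]
  · intro v
    simp [hYx, hZx]

/-- Lets lifted matrices be built without normalizing the corner entry to 1. -/
theorem col_none_mem_homCone_lsPlus {Y : Matrix (Option V) (Option V) ℝ} (hY : Y ∈ lsPlusLift P)
    (h0 : 0 < Y none none) : Y.col none ∈ homCone (lsPlus P) := by
  refine mem_homCone_of_pos h0 ⟨(Y none none)⁻¹ • Y, lsPlusLift_smul hY (by positivity), ?_, ?_⟩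
  · simp [h0.ne']
  · intro v
    simp [div_eq_inv_mul]

theorem posSemidef_symm {Y : Matrix (Option V) (Option V) ℝ} (hY : Y.PosSemidef) (a b) :
    Y a b = Y b a := by
  simpa using hY.1.apply b a

theorem lsPlus_subset [Nonempty V] (hP : Convex ℝ P) : lsPlus P ⊆ P := by
  rintro x ⟨Y, hY, hY0, hYx⟩
  obtain ⟨v⟩ := ‹Nonempty V›
  apply mem_of_homPoint_mem_homCone
  convert homCone_add hP (hY.2.2 v).1 (hY.2.2 v).2 using 1
  ext o
  cases o <;> simp [hY0, hYx]

theorem mem_lsPlus_of_zero_one [Fintype V] {x : V → ℝ} (hx : x ∈ P)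
    (h01 : ∀ v, x v = 0 ∨ x v = 1) : x ∈ lsPlus P := by
  refine ⟨vecMulVec (homPoint x) (homPoint x), ⟨?_, ?_, fun v => ⟨?_, ?_⟩⟩, ?_, ?_⟩
  · simpa using posSemidef_vecMulVec_self_star (homPoint x)
  · ext o
    cases o with
    | none => simp [vecMulVec_apply]
    | some v => rcases h01 v with h | h <;> simp [vecMulVec_apply, h]
  · have : (vecMulVec (homPoint x) (homPoint x)).col (some v) = x v • homPoint x := by
      ext o; simp [vecMulVec_apply, mul_comm]
    rw [this]
    exact homCone_smul (homPoint_mem_homCone hx) (by rcases h01 v with h | h <;> simp [h])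
  · have : (vecMulVec (homPoint x) (homPoint x)).col none -
        (vecMulVec (homPoint x) (homPoint x)).col (some v) = (1 - x v) • homPoint x := by
      ext o; simp [vecMulVec_apply]; ring
    rw [this]
    exact homCone_smul (homPoint_mem_homCone hx) (by rcases h01 v with h | h <;> simp [h])
  · simp [vecMulVec_apply]
  · simp [vecMulVec_apply]

/-- A linear map sending a face of the cone over `P` into the cone over `Q`, all of whose
coordinates are of the form `0`, `y₀`, `y_u` or `y₀ - y_u`, does the same for `LS₊`. -/
theorem mulVec_mem_lsPlus [Fintype V] [DecidableEq V] [Nonempty V] (hP : Convex ℝ P)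
    (hne : P.Nonempty) (hnn : ∀ x ∈ P, ∀ v, 0 ≤ x v) (Z : Set V)
    (A : Matrix (Option V) (Option V) ℝ) (hA0 : A none = Pi.single none 1)
    (hA : ∀ v, A (some v) = 0 ∨ A (some v) = Pi.single none 1 ∨
      ∃ u, A (some v) = Pi.single (some u) 1 ∨
        A (some v) = Pi.single none 1 - Pi.single (some u) 1)
    (H : ∀ y ∈ homCone P, (∀ z ∈ Z, y (some z) = 0) → A *ᵥ y ∈ homCone Q)
    {x : V → ℝ} (hx : x ∈ lsPlus P) (hxZ : ∀ z ∈ Z, x z = 0) :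
    (fun v => (A *ᵥ homPoint x) (some v)) ∈ lsPlus Q := by
  obtain ⟨Y, hY, hY0, hYx⟩ := hx
  have hsymm := posSemidef_symm hY.1
  have hdiag : ∀ a, Y a none = Y a a := fun a => congrFun hY.2.1 a
  have hcol0 : Y *ᵥ Pi.single none 1 = homPoint x := by
    ext o; cases o <;> simp [hY0, hYx]
  have hcolv : ∀ u : V, Y *ᵥ Pi.single (some u) 1 ∈ homCone P := fun u => by
    simpa using (hY.2.2 u).1
  have hcolv' : ∀ u : V, Y *ᵥ (Pi.single none 1 - Pi.single (some u) 1) ∈ homCone P := fun u => by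
    simpa [mulVec_sub] using (hY.2.2 u).2
  have hcoln : Y *ᵥ Pi.single none 1 ∈ homCone P := by
    obtain ⟨u⟩ := ‹Nonempty V›
    convert homCone_add hP (hcolv u) (hcolv' u) using 1
    rw [mulVec_sub]; abel
  -- A coordinate vanishing in `Y e₀` vanishes in all columns, since `Y e_v` and `Y (e₀ - e_v)` are
  -- both nonnegative there. So every column lies on the same face and `H` applies to it.
  have hYZ : ∀ z ∈ Z, ∀ b, Y (some z) b = 0 := by
    intro z hz b
    have h0 : Y (some z) none = 0 := by rw [hYx, hxZ z hz]
    cases b with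
    | none => exact h0
    | some v =>
      have h1 := homCone_nonneg hnn (hY.2.2 v).1 (some z)
      have h2 := homCone_nonneg hnn (hY.2.2 v).2 (some z)
      simp only [Matrix.col_apply, Pi.sub_apply] at h1 h2
      linarith
  have hYZ' : ∀ r : Option V → ℝ, ∀ z ∈ Z, (Y *ᵥ r) (some z) = 0 := by
    intro r z hz
    simp [mulVec, dotProduct, hYZ z hz]
  have hmem : ∀ v, Y *ᵥ A (some v) ∈ homCone P ∧
      Y *ᵥ (Pi.single none 1 - A (some v)) ∈ homCone P := by
    intro v
    rcases hA v with h | h | ⟨u, h | h⟩ <;> rw [h]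
    · exact ⟨by simpa using zero_mem_homCone hne, by simpa using hcoln⟩
    · exact ⟨hcoln, by simpa using zero_mem_homCone hne⟩
    · exact ⟨hcolv u, hcolv' u⟩
    · exact ⟨hcolv' u, by simpa using hcolv u⟩
  have hcol : ∀ b, (A * Y * Aᵀ).col b = A *ᵥ (Y *ᵥ A b) := by
    intro b
    ext a
    simp only [col_apply, mul_assoc, mulVec, dotProduct, Matrix.mul_apply, transpose_apply]
  have hcoln : (A * Y * Aᵀ).col none = A *ᵥ homPoint x := by rw [hcol, hA0, hcol0]
  refine ⟨A * Y * Aᵀ, ⟨?_, ?_, fun v => ⟨?_, ?_⟩⟩, ?_, fun v => congrFun hcoln (some v)⟩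
  · simpa using hY.1.mul_mul_conjTranspose_same A
  -- The diagonal condition says `rᵀ Y e₀ = rᵀ Y r` for each row `r` of `A`. It holds for the four
  -- allowed row shapes because `Y e₀ = diag Y`.
  · ext a
    have h1 : (A * Y * Aᵀ).col none a = A a ⬝ᵥ (Y *ᵥ A none) := by rw [hcol]; rfl
    have h2 : (A * Y * Aᵀ).diag a = A a ⬝ᵥ (Y *ᵥ A a) := by
      have := congrFun (hcol a) a
      exact this
    rw [h1, h2, hA0]
    cases a with
    | none => rw [hA0]
    | some v =>
      rcases hA v with h | h | ⟨u, h | h⟩ <;> rw [h]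
      · simp
      · simp [hdiag]
      · simp [mulVec_sub, hdiag, hsymm none (some u)]
  · rw [hcol]
    exact H _ (hmem v).1 (hYZ' _)
  · rw [hcol, hcol, ← mulVec_sub, hA0, ← mulVec_sub]
    exact H _ (hmem v).2 (hYZ' _)
  · have := congrFun hcoln none
    simp only [col_apply] at this
    rw [this]
    simp [mulVec, hA0]

end LsPlus

/-! ### The iterates of the fractional stable set polytope. -/

section FracStab

variable {V : Type*} (G : SimpleGraph V)

theorem convex_fracStab : Convex ℝ (fracStab G) := by
  rintro x ⟨hx1, hx2⟩ y ⟨hy1, hy2⟩ a b ha hb hab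
  refine ⟨fun v => ⟨?_, ?_⟩, fun u v h => ?_⟩ <;>
    simp only [Pi.add_apply, Pi.smul_apply, smul_eq_mul]
  · have := (hx1 v).1; have := (hy1 v).1; positivity
  · nlinarith [(hx1 v).2, (hy1 v).2]
  · nlinarith [hx2 u v h, hy2 u v h]

theorem convex_lsPlusIter_fracStab (k : ℕ) : Convex ℝ (lsPlusIter (fracStab G) k) := by
  induction k with
  | zero => exact convex_fracStab G
  | succ k ih => exact convex_lsPlus ih

theorem lsPlusIter_fracStab_succ_subset [Nonempty V] (k : ℕ) :
    lsPlusIter (fracStab G) (k + 1) ⊆ lsPlusIter (fracStab G) k :=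
  lsPlus_subset (convex_lsPlusIter_fracStab G k)

theorem lsPlusIter_fracStab_antitone [Nonempty V] : Antitone (lsPlusIter (fracStab G)) :=
  antitone_nat_of_succ_le (lsPlusIter_fracStab_succ_subset G)

theorem lsPlusIter_fracStab_subset [Nonempty V] (k : ℕ) :
    lsPlusIter (fracStab G) k ⊆ fracStab G :=
  lsPlusIter_fracStab_antitone G (Nat.zero_le k)

variable [Fintype V]

theorem integerHull_subset_lsPlusIter (k : ℕ) :
    integerHull (fracStab G) ⊆ lsPlusIter (fracStab G) k := by
  refine convexHull_min ?_ (convex_lsPlusIter_fracStab G k)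
  rintro x ⟨hx, h01⟩
  induction k with
  | zero => exact hx
  | succ k ih => exact mem_lsPlus_of_zero_one ih h01

/-- The homogenized `k`-th iterate of `LS₊` applied to the fractional stable set polytope. -/
abbrev lsCone (k : ℕ) : Set (Option V → ℝ) := homCone (lsPlusIter (fracStab G) k)

theorem lsPlusIter_fracStab_nonempty (k : ℕ) : (lsPlusIter (fracStab G) k).Nonempty := by
  refine ⟨0, integerHull_subset_lsPlusIter G k (subset_convexHull ℝ _ ⟨⟨?_, ?_⟩, ?_⟩)⟩ <;> simp

variable {G}

/-- It suffices to check a coordinate map on the edge inequalities: compatibility with `LS₊` then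
carries it through all levels. -/
theorem mulVec_mem_lsCone [DecidableEq V] [Nonempty V] (Z : Set V)
    (A : Matrix (Option V) (Option V) ℝ) (hA0 : A none = Pi.single none 1)
    (hA : ∀ v, A (some v) = 0 ∨ A (some v) = Pi.single none 1 ∨
      ∃ u, A (some v) = Pi.single (some u) 1 ∨
        A (some v) = Pi.single none 1 - Pi.single (some u) 1)
    (H : ∀ x ∈ fracStab G, (∀ z ∈ Z, x z = 0) →
      (fun v => (A *ᵥ homPoint x) (some v)) ∈ fracStab G)
    (k : ℕ) {y : Option V → ℝ} (hy : y ∈ lsCone G k) (hyZ : ∀ z ∈ Z, y (some z) = 0) :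
    A *ᵥ y ∈ lsCone G k := by
  have key : ∀ P : Set (V → ℝ), P.Nonempty → (∀ x ∈ P, (∀ z ∈ Z, x z = 0) →
      (fun v => (A *ᵥ homPoint x) (some v)) ∈ P) →
      ∀ y ∈ homCone P, (∀ z ∈ Z, y (some z) = 0) → A *ᵥ y ∈ homCone P := by
    rintro P hne hP y ⟨c, hc, x, hx, h0, h⟩ hyZ
    have hyx : y = c • homPoint x := by ext o; cases o <;> simp [h0, h]
    rcases hc.eq_or_lt with rfl | hc
    · rw [hyx]; simpa using zero_mem_homCone hne
    · have hxZ : ∀ z ∈ Z, x z = 0 := fun z hz => by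
        have := hyZ z hz
        rw [h] at this
        exact (mul_eq_zero.1 this).resolve_left hc.ne'
      rw [hyx, mulVec_smul]
      refine homCone_smul ?_ hc.le
      convert homPoint_mem_homCone (hP x hx hxZ) using 1
      ext o
      cases o with
      | none => simp [mulVec, hA0]
      | some v => rfl
  induction k generalizing y with
  | zero => exact key _ (lsPlusIter_fracStab_nonempty G 0) H y hy hyZ
  | succ k ih =>
    refine key _ (lsPlusIter_fracStab_nonempty G (k + 1)) (fun x hx hxZ => ?_) y hy hyZ
    exact mulVec_mem_lsPlus (convex_lsPlusIter_fracStab G k) (lsPlusIter_fracStab_nonempty G k)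
      (fun x hx v => ((lsPlusIter_fracStab_subset G k hx).1 v).1) Z A hA0 hA
      (fun y hy => ih hy) hx hxZ

end FracStab

/-! ### The stable set polytope through weight functions. -/

section StableHull

variable {V : Type*} [DecidableEq V] {G : SimpleGraph V}

/-- The 0-1 indicator vector of a finite set. -/
def chi (S : Finset V) : V → ℝ := fun v => if v ∈ S then 1 else 0

theorem chi_apply (S : Finset V) (v : V) : chi S v = if v ∈ S then 1 else 0 := rfl

variable [Fintype V]

theorem sum_mul_chi (a : V → ℝ) (S : Finset V) : ∑ v, a v * chi S v = ∑ v ∈ S, a v := by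
  simp [chi_apply]

theorem zeroOne_fracStab_eq :
    {x | x ∈ fracStab G ∧ ∀ v, x v = 0 ∨ x v = 1} =
      chi '' {S : Finset V | G.IsIndepSet (S : Set V)} := by
  ext x
  constructor
  · rintro ⟨hx, h01⟩
    refine ⟨Finset.univ.filter fun v => x v = 1, ?_, ?_⟩
    · intro u hu v hv _ hadj
      simp only [Finset.coe_filter, Finset.mem_univ, true_and, Set.mem_ofPred_eq] at hu hv
      have := hx.2 u v hadj
      linarith
    · ext v
      rcases h01 v with h | h <;> simp [chi_apply, h]
  · rintro ⟨S, hS, rfl⟩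
    refine ⟨⟨fun v => ?_, fun u v h => ?_⟩, fun v => ?_⟩
    · rw [chi_apply]; split_ifs <;> norm_num
    · have : ¬ (u ∈ S ∧ v ∈ S) := fun ⟨hu, hv⟩ => hS hu hv h.ne h
      simp only [chi_apply]
      split_ifs <;> simp_all
    · rw [chi_apply]; split_ifs <;> simp

theorem chi_mem_integerHull {S : Finset V} (hS : G.IsIndepSet (S : Set V)) :
    chi S ∈ integerHull (fracStab G) := by
  apply subset_convexHull
  rw [zeroOne_fracStab_eq]
  exact ⟨S, hS, rfl⟩

theorem exists_indep_of_mem_integerHull {x : V → ℝ} (hx : x ∈ integerHull (fracStab G))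
    (a : V → ℝ) : ∃ S : Finset V, G.IsIndepSet (S : Set V) ∧ ∑ v, a v * x v ≤ ∑ v ∈ S, a v := by
  obtain ⟨S, hS, hmax⟩ := Finset.exists_max_image
    ((Set.toFinite {S : Finset V | G.IsIndepSet (S : Set V)}).toFinset) (fun S => ∑ v ∈ S, a v)
    ⟨∅, by simp⟩
  simp only [Set.Finite.mem_toFinset, Set.mem_ofPred_eq] at hS hmax
  refine ⟨S, hS, ?_⟩
  have hconv : Convex ℝ {y : V → ℝ | ∑ v, a v * y v ≤ ∑ v ∈ S, a v} := by
    intro y hy z hz s t hs ht hst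
    simp only [Set.mem_ofPred_eq] at hy hz ⊢
    have : ∑ v, a v * (s • y + t • z) v = s * ∑ v, a v * y v + t * ∑ v, a v * z v := by
      simp only [Pi.add_apply, Pi.smul_apply, smul_eq_mul, Finset.mul_sum,
        ← Finset.sum_add_distrib]
      exact Finset.sum_congr rfl fun v _ => by ring
    rw [this]
    calc _ ≤ s * ∑ v ∈ S, a v + t * ∑ v ∈ S, a v := by gcongr
      _ = ∑ v ∈ S, a v := by rw [← add_mul, hst, one_mul]
  refine convexHull_min ?_ hconv hx
  rw [zeroOne_fracStab_eq]
  rintro _ ⟨S', hS', rfl⟩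
  simp only [Set.mem_ofPred_eq, sum_mul_chi]
  exact hmax S' hS'

/-- Nonnegative weights suffice because stable sets are closed under taking subsets: given a
separating functional, pass to its positive part and drop from `S` the vertices of negative weight.
-/
theorem mem_integerHull_of_forall_nonneg {x : V → ℝ} (hx : ∀ v, 0 ≤ x v)
    (h : ∀ a : V → ℝ, (∀ v, 0 ≤ a v) →
      ∃ S : Finset V, G.IsIndepSet (S : Set V) ∧ ∑ v, a v * x v ≤ ∑ v ∈ S, a v) :
    x ∈ integerHull (fracStab G) := by
  by_contra hx'
  have hfin : {x | x ∈ fracStab G ∧ ∀ v, x v = 0 ∨ x v = 1}.Finite := by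
    rw [zeroOne_fracStab_eq]; exact Set.toFinite _
  obtain ⟨f, u, hf1, hf2⟩ := geometric_hahn_banach_closed_point
    (convex_convexHull ℝ _) (hfin.isClosed_convexHull (𝕜 := ℝ)) hx'
  have hf : ∀ y : V → ℝ, f y = ∑ v, f (Pi.single v 1) * y v := by
    intro y
    conv_lhs => rw [pi_eq_sum_univ' y]
    simp only [map_sum, map_smul, smul_eq_mul]
    refine Finset.sum_congr rfl fun v _ => ?_
    rw [mul_comm]
  obtain ⟨S, hS, hle⟩ := h (fun v => max (f (Pi.single v 1)) 0) fun v => le_max_right _ _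
  have h1 : f x ≤ ∑ v, max (f (Pi.single v 1)) 0 * x v := by
    rw [hf]
    exact Finset.sum_le_sum fun v _ => mul_le_mul_of_nonneg_right (le_max_left _ _) (hx v)
  have h2 : f (chi (S.filter fun v => 0 ≤ f (Pi.single v 1))) =
      ∑ v ∈ S, max (f (Pi.single v 1)) 0 := by
    rw [hf, sum_mul_chi, Finset.sum_filter]
    refine Finset.sum_congr rfl fun v _ => ?_
    split_ifs with h
    · rw [max_eq_left h]
    · rw [max_eq_right (le_of_not_ge h)]
  have h3 := hf1 _ (chi_mem_integerHull
    (S := S.filter fun v => 0 ≤ f (Pi.single v 1))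
    (hS.mono fun v hv => (Finset.mem_filter.1 hv).1))
  linarith

end StableHull

/-! ### Upper bound: `3k + 2` vertices are handled by `k` rounds. -/

section UpperBound

variable {V : Type*} [Fintype V] [DecidableEq V] {G : SimpleGraph V}

theorem restrict_mem_lsCone [Nonempty V] (W : Finset V) {k : ℕ} {y : Option V → ℝ}
    (hy : y ∈ lsCone G k) :
    (fun o : Option V => o.elim (y none) fun v => if v ∈ W then y (some v) else 0) ∈
      lsCone G k := by
  let A : Matrix (Option V) (Option V) ℝ := fun o => o.elim (Pi.single none 1)
    fun v => if v ∈ W then Pi.single (some v) 1 else 0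
  have hA : ∀ y : Option V → ℝ, A *ᵥ y =
      fun o : Option V => o.elim (y none) fun v => if v ∈ W then y (some v) else 0 := by
    intro y
    ext o
    cases o with
    | none => simp [A, mulVec]
    | some v => by_cases hv : v ∈ W <;> simp [A, mulVec, hv]
  rw [← hA]
  refine mulVec_mem_lsCone ∅ A rfl (fun v => ?_) (fun x hx _ => ?_) k hy (by simp)
  · by_cases hv : v ∈ W
    · exact Or.inr (Or.inr ⟨v, Or.inl (by simp [A, hv])⟩)
    · exact Or.inl (by simp [A, hv])
  · rw [hA]
    refine ⟨fun v => ?_, fun u v h => ?_⟩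
    · by_cases hv : v ∈ W <;> simp [hv, hx.1 v]
    · have := hx.2 u v h
      have := (hx.1 u).1
      have := (hx.1 v).1
      by_cases hu : u ∈ W <;> by_cases hv : v ∈ W <;> simp [hu, hv] <;> linarith

/-- Charge the weight of `v` to the inequality `x_v + ∑_{N} x_w ≤ 1`, which is an edge or a bound
because `|N| ≤ 1`. The remaining weight `a'` lowers the neighbour by `a v`, and an optimal stable
set for `a'` is repaired at a gain of `a v`. -/
theorem mem_integerHull_of_neighbors_le_one {x : V → ℝ} (hx : x ∈ fracStab G) {W : Finset V}
    (hxW : ∀ v ∉ W, x v = 0) {v : V} {N : Finset V}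
    (hN : ∀ w, w ∈ N ↔ w ∈ W ∧ G.Adj v w) (hcard : N.card ≤ 1)
    (hz : (fun w => if w ∈ W.erase v then x w else 0) ∈ integerHull (fracStab G)) :
    x ∈ integerHull (fracStab G) := by
  have : Nonempty V := ⟨v⟩
  refine mem_integerHull_of_forall_nonneg (fun v => (hx.1 v).1) fun a ha => ?_
  have hvN : v ∉ N := fun h => G.loopless.irrefl v ((hN v).1 h).2
  have hsum : x v + ∑ w ∈ N, x w ≤ 1 := by
    rcases Finset.card_le_one_iff_subset_singleton.1 hcard with ⟨u, hu⟩
    rcases Finset.subset_singleton_iff.1 hu with rfl | rfl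
    · simpa using (hx.1 v).2
    · simpa using hx.2 v u ((hN u).1 (by simp)).2
  let a' : V → ℝ := fun w =>
    if w ∈ W.erase v then (if w ∈ N then max (a w - a v) 0 else a w) else 0
  have ha'le : ∀ w, a' w ≤ a w := by
    intro w
    simp only [a']
    split_ifs
    · exact max_le (by linarith [ha v]) (ha w)
    · exact le_rfl
    · exact ha w
  obtain ⟨S, hS, hle⟩ := exists_indep_of_mem_integerHull hz a'
  have h1 : ∑ w, a w * x w ≤ ∑ w ∈ S, a' w + a v := by
    have hterm : ∀ w, a w * x w ≤ a' w * (if w ∈ W.erase v then x w else 0) +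
        a v * ((if w = v then x v else 0) + if w ∈ N then x w else 0) := by
      intro w
      have hxw := (hx.1 w).1
      by_cases hwv : w = v
      · subst hwv; simp [hvN]
      by_cases hwW : w ∈ W
      · by_cases hwN : w ∈ N
        · simp only [a', Finset.mem_erase, hwv, hwW, hwN, ne_eq, not_false_eq_true, and_self,
            if_true, if_false, zero_add]
          nlinarith [le_max_left (a w - a v) 0]
        · simp [a', hwv, hwW, hwN]
      · have : w ∉ N := fun h => hwW ((hN w).1 h).1
        simp [hxW w hwW, this, hwv]
    calc ∑ w, a w * x w ≤ ∑ w, (a' w * (if w ∈ W.erase v then x w else 0) +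
        a v * ((if w = v then x v else 0) + if w ∈ N then x w else 0)) :=
          Finset.sum_le_sum fun w _ => hterm w
      _ = ∑ w, a' w * (if w ∈ W.erase v then x w else 0) + a v * (x v + ∑ w ∈ N, x w) := by
          rw [Finset.sum_add_distrib, ← Finset.mul_sum, Finset.sum_add_distrib]
          simp
      _ ≤ ∑ w ∈ S, a' w + a v := by nlinarith [ha v]
  have h2 : ∑ w ∈ S, a' w = ∑ w ∈ S ∩ W.erase v, a' w := by
    symm
    refine Finset.sum_subset Finset.inter_subset_left fun w hw hw' => ?_
    have : w ∉ W.erase v := fun h => hw' (Finset.mem_inter.2 ⟨hw, h⟩)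
    simp only [a', this, if_false]
  -- If the set uses the neighbour where `a'` was lowered by exactly `a v`, restoring the weight
  -- gains `a v`. Otherwise the neighbour counts for nothing in `a'`, and it can be replaced by `v`.
  by_cases hu : ∃ u ∈ S ∩ W.erase v, u ∈ N ∧ a v ≤ a u
  · obtain ⟨u, hu, huN, hau⟩ := hu
    refine ⟨S ∩ W.erase v, hS.mono (by simp), h1.trans ?_⟩
    rw [h2, ← Finset.add_sum_erase _ _ hu, ← Finset.add_sum_erase (S ∩ W.erase v) a hu]
    have h3 : a' u + a v = a u := by
      simp only [a', (Finset.mem_inter.1 hu).2, huN, if_true]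
      rw [max_eq_left (by linarith)]; ring
    have h4 := Finset.sum_le_sum (s := (S ∩ W.erase v).erase u) fun w _ => ha'le w
    linarith
  · push Not at hu
    have hv' : v ∉ (S ∩ W.erase v) \ N := by simp
    refine ⟨insert v ((S ∩ W.erase v) \ N), ?_, h1.trans ?_⟩
    · rw [Finset.coe_insert]
      refine (SimpleGraph.isIndepSet_iff _).2 (Set.Pairwise.insert ?_ ?_)
      · exact hS.mono fun w hw => by
          simp only [Finset.coe_sdiff, Finset.coe_inter, Set.mem_sdiff, Set.mem_inter_iff] at hw
          exact hw.1.1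
      · intro w hw _
        simp only [Finset.coe_sdiff, Finset.coe_inter, Set.mem_sdiff, Set.mem_inter_iff,
          Finset.mem_coe, Finset.mem_erase] at hw
        have : ¬ G.Adj v w := fun h => hw.2 ((hN w).2 ⟨hw.1.2.2, h⟩)
        exact ⟨this, fun h => this h.symm⟩
    · rw [h2, Finset.sum_insert hv', ← Finset.sum_inter_add_sum_sdiff (S ∩ W.erase v) N a']
      have h3 : ∑ w ∈ (S ∩ W.erase v) ∩ N, a' w = 0 := by
        refine Finset.sum_eq_zero fun w hw => ?_
        rw [Finset.mem_inter] at hw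
        simp only [a', (Finset.mem_inter.1 hw.1).2, hw.2, if_true]
        exact max_eq_right (by linarith [hu w hw.1 hw.2])
      have h4 := Finset.sum_le_sum (s := (S ∩ W.erase v) \ N) fun w _ => ha'le w
      linarith

/-- If the columns `Y e_v` are in the cone of the stable set polytope, then so is `Y e₀`. -/
theorem mem_integerHull_of_columns {P : Set (V → ℝ)} {Y : Matrix (Option V) (Option V) ℝ}
    (hY : Y ∈ lsPlusLift P) (hY0 : Y none none = 1) {x : V → ℝ} (hYx : ∀ v, Y (some v) none = x v)
    (hx : ∀ v, 0 ≤ x v)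
    (hcol : ∀ v, ∀ a : V → ℝ, (∀ v, 0 ≤ a v) → ∃ S : Finset V, G.IsIndepSet (S : Set V) ∧
      ∑ w, a w * Y (some w) (some v) ≤ (∑ w ∈ S, a w) * Y none (some v)) :
    x ∈ integerHull (fracStab G) := by
  have hsymm := posSemidef_symm hY.1
  refine mem_integerHull_of_forall_nonneg hx fun a ha => ?_
  obtain ⟨S, hS, hmax⟩ := Finset.exists_max_image
    ((Set.toFinite {S : Finset V | G.IsIndepSet (S : Set V)}).toFinset) (fun S => ∑ v ∈ S, a v)
    ⟨∅, by simp⟩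
  simp only [Set.Finite.mem_toFinset, Set.mem_ofPred_eq] at hS hmax
  refine ⟨S, hS, ?_⟩
  set b := ∑ v ∈ S, a v with hb
  have hb0 : 0 ≤ b := Finset.sum_nonneg fun v _ => ha v
  have hle : ∀ v, ∑ w, a w * Y (some w) (some v) ≤ b * Y none (some v) := by
    intro v
    obtain ⟨S', hS', h⟩ := hcol v a ha
    refine h.trans (mul_le_mul_of_nonneg_right (hmax S' hS') ?_)
    rw [hsymm, hYx]; exact hx v
  -- Test `Y` on `(-b, a)`. The columns give `aᵀ Y a ≤ b (a · x)`, so the quadratic form leaves `0 ≤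
  -- b (b - a · x)`.
  have hq := hY.1.dotProduct_mulVec_nonneg (fun o : Option V => o.elim (-b) a)
  simp only [dotProduct, mulVec, Fintype.sum_option, Pi.star_apply, star_trivial,
    Option.elim] at hq
  have h1 : ∑ v, a v * (Y (some v) none * -b + ∑ w, Y (some v) (some w) * a w) ≤ 0 := by
    refine Finset.sum_nonpos fun v _ => mul_nonpos_of_nonneg_of_nonpos (ha v) ?_
    have := hle v
    simp only [hsymm none (some v)] at this
    have h2 : ∑ w, Y (some v) (some w) * a w = ∑ w, a w * Y (some w) (some v) :=
      Finset.sum_congr rfl fun w _ => by rw [hsymm, mul_comm]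
    rw [h2]; linarith
  have h3 : ∑ w, Y none (some w) * a w = ∑ v, a v * x v :=
    Finset.sum_congr rfl fun w _ => by rw [hsymm, hYx, mul_comm]
  rw [h3, hY0] at hq
  rcases hb0.eq_or_lt' with h0 | h0
  · have ha0 : ∀ v, a v = 0 := fun v => by
      have := hmax {v} (by simp)
      simp only [Finset.sum_singleton] at this
      linarith [ha v]
    simp [ha0, h0]
  · nlinarith

/-- The support `W` is carried separately from the vertex set so that deleting vertices becomes
setting coordinates to zero. The induction is on `|W|`, with the level `k` varying. -/
theorem mem_integerHull_of_card_le (n : ℕ) : ∀ (k : ℕ) (W : Finset V), W.card = n →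
    n ≤ 3 * k + 2 → ∀ x ∈ lsPlusIter (fracStab G) k, (∀ v ∉ W, x v = 0) →
      x ∈ integerHull (fracStab G) := by
  induction n using Nat.strong_induction_on with
  | _ n ih =>
  intro k W hW hn x hx hxW
  rcases W.eq_empty_or_nonempty with rfl | ⟨v₀, hv₀⟩
  · have : x = chi ∅ := by ext v; simp [chi_apply, hxW v]
    rw [this]
    exact chi_mem_integerHull (by simp)
  have : Nonempty V := ⟨v₀⟩
  have hxf := lsPlusIter_fracStab_subset G k hx
  classical
  by_cases hdeg : ∃ v ∈ W, (W.filter fun w => G.Adj v w).card ≤ 1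
  · obtain ⟨v, hv, hdeg⟩ := hdeg
    refine mem_integerHull_of_neighbors_le_one hxf hxW (v := v)
      (fun w => by simp only [Finset.mem_filter]) hdeg ?_
    refine ih (W.erase v).card ?_ k (W.erase v) rfl ?_ _ ?_ ?_
    · rw [← hW]; exact Finset.card_erase_lt_of_mem hv
    · exact (Finset.card_erase_le.trans hW.le).trans hn
    · apply mem_of_homPoint_mem_homCone
      convert restrict_mem_lsCone (W.erase v) (homPoint_mem_homCone hx) using 1
      ext o
      cases o <;> rfl
    · intro w hw
      rw [if_neg hw]
  · push Not at hdeg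
    -- The vertex itself and two neighbours are lost, exactly the three vertices that one round pays
    -- for. This also rules out `k = 0`, where `n ≤ 2`.
    have hcardN : ∀ v ∈ W, (W.filter fun w => w ≠ v ∧ ¬ G.Adj v w).card + 3 ≤ n := by
      intro v hv
      have h1 : insert v (W.filter fun w => G.Adj v w) ⊆ W := by
        intro w hw
        rcases Finset.mem_insert.1 hw with rfl | hw
        · exact hv
        · exact (Finset.mem_filter.1 hw).1
      have h2 : (W.filter fun w => w ≠ v ∧ ¬ G.Adj v w) =
          W \ insert v (W.filter fun w => G.Adj v w) := by
        ext w
        simp only [Finset.mem_filter, Finset.mem_sdiff, Finset.mem_insert]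
        tauto
      have h3 := Finset.card_sdiff_add_card_eq_card h1
      have h4 : (insert v (W.filter fun w => G.Adj v w)).card =
          (W.filter fun w => G.Adj v w).card + 1 := by
        apply Finset.card_insert_of_notMem
        simp
      have := hdeg v hv
      rw [h2]
      omega
    have hk : k ≠ 0 := by
      rintro rfl
      have := hcardN v₀ hv₀
      omega
    obtain ⟨k, rfl⟩ := Nat.exists_eq_succ_of_ne_zero hk
    have hxnn : ∀ v, 0 ≤ x v := fun v => (hxf.1 v).1
    obtain ⟨Y, hY, hY0, hYx⟩ := hx
    have hsymm := posSemidef_symm hY.1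
    have hPnn : ∀ y ∈ lsPlusIter (fracStab G) k, ∀ v, 0 ≤ y v :=
      fun y hy v => ((lsPlusIter_fracStab_subset G k hy).1 v).1
    have hdiag : ∀ v, Y (some v) (some v) = x v := fun v => by
      rw [← hYx]; exact (congrFun hY.2.1 (some v)).symm
    refine mem_integerHull_of_columns hY hY0 hYx hxnn fun v a ha => ?_
    have hcol := (hY.2.2 v).1
    have hcolnn : ∀ o, 0 ≤ Y o (some v) := homCone_nonneg hPnn hcol
    have hcolle : ∀ w, Y (some w) (some v) ≤ x w := fun w => by
      have := homCone_nonneg hPnn (hY.2.2 v).2 (some w)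
      simp only [Pi.sub_apply, col_apply, hYx] at this
      linarith
    have h0v : Y none (some v) = x v := by rw [hsymm, hYx]
    rcases (hxnn v).eq_or_lt' with hv0 | hv0
    · refine ⟨∅, by simp, ?_⟩
      have : ∀ w, Y (some w) (some v) = 0 := fun w => by
        have h1 := hcolle v
        have h2 := homCone_nonneg hPnn (hY.2.2 w).1 (some v)
        have h3 := homCone_nonneg hPnn (hY.2.2 w).2 (some v)
        simp only [Pi.sub_apply, col_apply, hYx] at h2 h3
        rw [hsymm]
        linarith
      simp [this]
    have hvW : v ∈ W := by
      by_contra h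
      exact hv0.ne' (hxW v h)
    -- The scaled column has `v`-coordinate 1, so the edge inequality forces the neighbours to 0.
    have hadj : ∀ w, G.Adj v w → Y (some w) (some v) = 0 := fun w hw => by
      have h1 := div_mem_of_mem_homCone hcol (by simpa [h0v] using hv0)
      have h2 := (lsPlusIter_fracStab_subset G k h1).2 v w hw
      simp only [col_apply, hdiag, h0v, div_self hv0.ne'] at h2
      have h3 : Y (some w) (some v) / x v = 0 :=
        le_antisymm (by linarith) (div_nonneg (hcolnn _) hv0.le)
      exact (div_eq_zero_iff.1 h3).resolve_right hv0.ne'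
    have hcardW' := hcardN v hvW
    set W' := W.filter fun w => w ≠ v ∧ ¬ G.Adj v w with hW'
    have hres := restrict_mem_lsCone W' hcol
    have hhull := ih W'.card (by omega) k W' rfl
      (by omega) _ (div_mem_of_mem_homCone hres (by simpa [h0v] using hv0))
      (fun w hw => by simp [hw])
    obtain ⟨S, hS, hle⟩ := exists_indep_of_mem_integerHull hhull
      (fun w => if w ∈ W' then a w else 0)
    simp only [Option.elim, col_apply, h0v] at hle
    have hvS : v ∉ S ∩ W' := by simp [hW']
    refine ⟨insert v (S ∩ W'), ?_, ?_⟩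
    · rw [Finset.coe_insert]
      refine (SimpleGraph.isIndepSet_iff _).2 (Set.Pairwise.insert ?_ ?_)
      · exact hS.mono (by simp)
      · intro w hw _
        simp only [hW', Finset.coe_inter, Set.mem_inter_iff, Finset.mem_coe,
          Finset.mem_filter] at hw
        exact ⟨hw.2.2.2, fun h => hw.2.2.2 h.symm⟩
    · have h1 : ∑ w ∈ S ∩ W', a w = ∑ w ∈ S, if w ∈ W' then a w else 0 := by
        rw [← Finset.sum_filter, Finset.filter_mem_eq_inter]
      have h2 : ∑ w, a w * Y (some w) (some v) =
          a v * x v + x v * ∑ w, (if w ∈ W' then a w else 0) *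
            ((if w ∈ W' then Y (some w) (some v) else 0) / x v) := by
        rw [← Finset.add_sum_erase _ _ (Finset.mem_univ v), hdiag, Finset.mul_sum,
          ← Finset.add_sum_erase Finset.univ _ (Finset.mem_univ v)]
        have : v ∉ W' := by simp [hW']
        simp only [this, if_false, zero_mul, mul_zero, zero_add, add_right_inj]
        refine Finset.sum_congr rfl fun w hw => ?_
        by_cases hw' : w ∈ W'
        · simp only [hw', if_true]; field_simp
        · simp only [hw', if_false, zero_mul, mul_zero]
          have : Y (some w) (some v) = 0 := by
            by_cases hwW : w ∈ W
            · apply hadj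
              by_contra h
              exact hw' (Finset.mem_filter.2 ⟨hwW, (Finset.mem_erase.1 hw).1, h⟩)
            · have h1 := hcolle w
              rw [hxW w hwW] at h1
              exact le_antisymm h1 (hcolnn _)
          rw [this, mul_zero]
      rw [Finset.sum_insert hvS, h1, h2, h0v]
      nlinarith

theorem lsPlusIter_eq_integerHull {k : ℕ} (h : Fintype.card V ≤ 3 * k + 2) :
    lsPlusIter (fracStab G) k = integerHull (fracStab G) :=
  Set.Subset.antisymm
    (fun x hx => mem_integerHull_of_card_le _ k Finset.univ rfl h x hx (by simp))
    (integerHull_subset_lsPlusIter G k)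

end UpperBound

/-! ### Stretched cliques and their tight stable sets. -/

section StretchedClique

variable {V ι : Type*}

/-- `G` contains a 2-stretched clique with unstretched vertices `U`, stretched vertices indexed by
`D`, hubs `h i` and wings `w i a`, in which exactly one edge joins the wings of any two distinct
stretched vertices. -/
structure IsStretchedClique (G : SimpleGraph V) (h : ι → V) (w : ι → Fin 2 → V)
    (U : Finset V) (D : Finset ι) : Prop where
  adj_of_mem : ∀ u ∈ U, ∀ v ∈ U, u ≠ v → G.Adj u v
  hub_adj_wing : ∀ i ∈ D, ∀ a, G.Adj (h i) (w i a)
  wing_ne : ∀ i ∈ D, w i 0 ≠ w i 1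
  wing_not_adj : ∀ i ∈ D, ¬ G.Adj (w i 0) (w i 1)
  hub_notMem : ∀ i ∈ D, h i ∉ U
  wing_notMem : ∀ i ∈ D, ∀ a, w i a ∉ U
  hub_not_adj : ∀ i ∈ D, ∀ u ∈ U, ¬ G.Adj (h i) u
  exists_wing_adj : ∀ i ∈ D, ∀ u ∈ U, ∃ a, G.Adj (w i a) u
  hub_ne_hub : ∀ i ∈ D, ∀ j ∈ D, i ≠ j → h i ≠ h j
  hub_not_adj_hub : ∀ i ∈ D, ∀ j ∈ D, ¬ G.Adj (h i) (h j)
  hub_ne_wing : ∀ i ∈ D, ∀ j ∈ D, ∀ a, h i ≠ w j a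
  hub_not_adj_wing : ∀ i ∈ D, ∀ j ∈ D, i ≠ j → ∀ a, ¬ G.Adj (h i) (w j a)
  wing_ne_wing : ∀ i ∈ D, ∀ j ∈ D, i ≠ j → ∀ a b, w i a ≠ w j b
  wing_adj_wing : ∀ i ∈ D, ∀ j ∈ D, i ≠ j →
    ∃ a b, ∀ a' b', G.Adj (w i a') (w j b') ↔ a' = a ∧ b' = b

namespace IsStretchedClique

variable {G : SimpleGraph V} {h : ι → V} {w : ι → Fin 2 → V} {U U' : Finset V} {D D' : Finset ι}

theorem mono (hC : IsStretchedClique G h w U D) (hU : U' ⊆ U) (hD : D' ⊆ D) :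
    IsStretchedClique G h w U' D' where
  adj_of_mem u hu v hv := hC.adj_of_mem u (hU hu) v (hU hv)
  hub_adj_wing i hi := hC.hub_adj_wing i (hD hi)
  wing_ne i hi := hC.wing_ne i (hD hi)
  wing_not_adj i hi := hC.wing_not_adj i (hD hi)
  hub_notMem i hi hu := hC.hub_notMem i (hD hi) (hU hu)
  wing_notMem i hi a hu := hC.wing_notMem i (hD hi) a (hU hu)
  hub_not_adj i hi u hu := hC.hub_not_adj i (hD hi) u (hU hu)
  exists_wing_adj i hi u hu := hC.exists_wing_adj i (hD hi) u (hU hu)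
  hub_ne_hub i hi j hj := hC.hub_ne_hub i (hD hi) j (hD hj)
  hub_not_adj_hub i hi j hj := hC.hub_not_adj_hub i (hD hi) j (hD hj)
  hub_ne_wing i hi j hj := hC.hub_ne_wing i (hD hi) j (hD hj)
  hub_not_adj_wing i hi j hj := hC.hub_not_adj_wing i (hD hi) j (hD hj)
  wing_ne_wing i hi j hj := hC.wing_ne_wing i (hD hi) j (hD hj)
  wing_adj_wing i hi j hj := hC.wing_adj_wing i (hD hi) j (hD hj)

theorem wing_not_adj' (hC : IsStretchedClique G h w U D) {i : ι} (hi : i ∈ D) (a b : Fin 2) :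
    ¬ G.Adj (w i a) (w i b) := by
  have := hC.wing_not_adj i hi
  fin_cases a <;> fin_cases b <;> simp_all [G.adj_comm]

theorem wing_injective (hC : IsStretchedClique G h w U D) {i : ι} (hi : i ∈ D) {a b : Fin 2}
    (hab : a ≠ b) : w i a ≠ w i b := by
  have := hC.wing_ne i hi
  fin_cases a <;> fin_cases b <;> simp_all [eq_comm]

variable [DecidableEq V] [DecidableEq ι]

/-- A wing adjacent to all other parts can take over the role of its stretched vertex. -/
theorem of_full (hC : IsStretchedClique G h w U D) {j : ι} (hj : j ∈ D) {a : Fin 2}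
    (hU : ∀ u ∈ U, G.Adj (w j a) u) (hD : ∀ i ∈ D, i ≠ j → ∃ b, G.Adj (w j a) (w i b)) :
    IsStretchedClique G h w (insert (w j a) U) (D.erase j) where
  adj_of_mem u hu v hv huv := by
    rcases Finset.mem_insert.1 hu with rfl | hu <;> rcases Finset.mem_insert.1 hv with rfl | hv
    · exact absurd rfl huv
    · exact hU v hv
    · exact (hU u hu).symm
    · exact hC.adj_of_mem u hu v hv huv
  hub_adj_wing i hi := hC.hub_adj_wing i (Finset.mem_of_mem_erase hi)
  wing_ne i hi := hC.wing_ne i (Finset.mem_of_mem_erase hi)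
  wing_not_adj i hi := hC.wing_not_adj i (Finset.mem_of_mem_erase hi)
  hub_notMem i hi hu := by
    have hi' := Finset.mem_of_mem_erase hi
    rcases Finset.mem_insert.1 hu with h | h
    · exact hC.hub_ne_wing i hi' j hj a h
    · exact hC.hub_notMem i hi' h
  wing_notMem i hi b hu := by
    have hi' := Finset.mem_of_mem_erase hi
    rcases Finset.mem_insert.1 hu with h | h
    · exact hC.wing_ne_wing i hi' j hj (Finset.ne_of_mem_erase hi) b a h
    · exact hC.wing_notMem i hi' b h
  hub_not_adj i hi u hu := by
    have hi' := Finset.mem_of_mem_erase hi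
    rcases Finset.mem_insert.1 hu with rfl | h
    · exact hC.hub_not_adj_wing i hi' j hj (Finset.ne_of_mem_erase hi) a
    · exact hC.hub_not_adj i hi' u h
  exists_wing_adj i hi u hu := by
    have hi' := Finset.mem_of_mem_erase hi
    rcases Finset.mem_insert.1 hu with rfl | h
    · obtain ⟨b, hb⟩ := hD i hi' (Finset.ne_of_mem_erase hi)
      exact ⟨b, hb.symm⟩
    · exact hC.exists_wing_adj i hi' u h
  hub_ne_hub i hi j hj :=
    hC.hub_ne_hub i (Finset.mem_of_mem_erase hi) j (Finset.mem_of_mem_erase hj)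
  hub_not_adj_hub i hi j hj :=
    hC.hub_not_adj_hub i (Finset.mem_of_mem_erase hi) j (Finset.mem_of_mem_erase hj)
  hub_ne_wing i hi j hj :=
    hC.hub_ne_wing i (Finset.mem_of_mem_erase hi) j (Finset.mem_of_mem_erase hj)
  hub_not_adj_wing i hi j hj :=
    hC.hub_not_adj_wing i (Finset.mem_of_mem_erase hi) j (Finset.mem_of_mem_erase hj)
  wing_ne_wing i hi j hj :=
    hC.wing_ne_wing i (Finset.mem_of_mem_erase hi) j (Finset.mem_of_mem_erase hj)
  wing_adj_wing i hi j hj :=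
    hC.wing_adj_wing i (Finset.mem_of_mem_erase hi) j (Finset.mem_of_mem_erase hj)

end IsStretchedClique

variable [DecidableEq V] [DecidableEq ι]

/-- The vertices of a stretched clique. -/
def cliqueSupport (h : ι → V) (w : ι → Fin 2 → V) (U : Finset V) (D : Finset ι) : Finset V :=
  U ∪ D.biUnion fun i => {h i, w i 0, w i 1}

theorem mem_cliqueSupport {h : ι → V} {w : ι → Fin 2 → V} {U : Finset V} {D : Finset ι} {v : V} :
    v ∈ cliqueSupport h w U D ↔ v ∈ U ∨ ∃ i ∈ D, v = h i ∨ ∃ a, v = w i a := by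
  simp [cliqueSupport, Fin.exists_fin_two]

theorem cliqueSupport_mono {h : ι → V} {w : ι → Fin 2 → V} {U U' : Finset V} {D D' : Finset ι}
    (hU : U' ⊆ U) (hD : D' ⊆ D) : cliqueSupport h w U' D' ⊆ cliqueSupport h w U D := by
  intro v
  simp only [mem_cliqueSupport]
  rintro (hv | ⟨i, hi, hv⟩)
  · exact Or.inl (hU hv)
  · exact Or.inr ⟨i, hD hi, hv⟩

/-- A stable set meets `U` at most once and each triple of hub and wings at most once, except that
it may contain both wings. Two such excesses are incompatible: a vertex of `U` is adjacent to a wing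
of every triple, and any two triples are joined by a wing edge. So only one unit beyond `|D|` is
possible. -/
theorem IsStretchedClique.card_le_of_indep {G : SimpleGraph V} {h : ι → V} {w : ι → Fin 2 → V}
    {U : Finset V} {D : Finset ι} (hC : IsStretchedClique G h w U D) {S : Finset V}
    (hS : G.IsIndepSet (S : Set V)) (hSW : S ⊆ cliqueSupport h w U D) : S.card ≤ D.card + 1 := by
  have hind : ∀ {u v}, u ∈ S → v ∈ S → ¬ G.Adj u v := fun hu hv hadj => hS hu hv hadj.ne hadj
  let f : ι → ℕ := fun i => (S ∩ {h i, w i 0, w i 1}).card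
  have hcard : S.card ≤ (S ∩ U).card + ∑ i ∈ D, f i := by
    calc S.card ≤ ((S ∩ U) ∪ D.biUnion fun i => S ∩ {h i, w i 0, w i 1}).card := by
          apply Finset.card_le_card
          intro v hv
          have := hSW hv
          simp only [cliqueSupport, Finset.mem_union, Finset.mem_biUnion, Finset.mem_inter] at this ⊢
          rcases this with h | ⟨i, hi, h⟩
          · exact Or.inl ⟨hv, h⟩
          · exact Or.inr ⟨i, hi, hv, h⟩
      _ ≤ _ := (Finset.card_union_le _ _).trans (by gcongr; exact Finset.card_biUnion_le)
  have hU1 : (S ∩ U).card ≤ 1 := by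
    refine Finset.card_le_one.2 fun u hu v hv => ?_
    by_contra huv
    rw [Finset.mem_inter] at hu hv
    exact hind hu.1 hv.1 (hC.adj_of_mem u hu.2 v hv.2 huv)
  have hf1 : ∀ i ∈ D, ¬ (w i 0 ∈ S ∧ w i 1 ∈ S) → f i ≤ 1 := by
    intro i hi hw
    refine Finset.card_le_one.2 fun u hu v hv => ?_
    simp only [Finset.mem_inter, Finset.mem_insert, Finset.mem_singleton] at hu hv
    have h0 := hC.hub_adj_wing i hi 0
    have h1 := hC.hub_adj_wing i hi 1
    obtain ⟨huS, rfl | rfl | rfl⟩ := hu <;> obtain ⟨hvS, rfl | rfl | rfl⟩ := hv <;>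
      first
        | rfl
        | exact absurd h0 (hind huS hvS)
        | exact absurd h1 (hind huS hvS)
        | exact absurd h0 (hind hvS huS)
        | exact absurd h1 (hind hvS huS)
        | exact (hw ⟨huS, hvS⟩).elim
        | exact (hw ⟨hvS, huS⟩).elim
  have hf2 : ∀ i ∈ D, w i 0 ∈ S → f i ≤ 2 := by
    intro i hi h0
    have : S ∩ {h i, w i 0, w i 1} ⊆ {w i 0, w i 1} := by
      intro v hv
      simp only [Finset.mem_inter, Finset.mem_insert, Finset.mem_singleton] at hv ⊢
      obtain ⟨hvS, rfl | h | h⟩ := hv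
      · exact absurd (hC.hub_adj_wing i hi 0) (hind hvS h0)
      · exact Or.inl h
      · exact Or.inr h
    exact (Finset.card_le_card this).trans Finset.card_le_two
  have hsum1 : ∀ D' ⊆ D, (∀ i ∈ D', ¬ (w i 0 ∈ S ∧ w i 1 ∈ S)) → ∑ i ∈ D', f i ≤ D'.card := by
    intro D' hD' hw
    simpa using Finset.sum_le_card_nsmul D' f 1 fun i hi => hf1 i (hD' hi) (hw i hi)
  by_cases hu : ∃ u, u ∈ S ∩ U
  · obtain ⟨u, hu⟩ := hu
    rw [Finset.mem_inter] at hu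
    have := hsum1 D subset_rfl fun i hi hw => by
      obtain ⟨a, ha⟩ := hC.exists_wing_adj i hi u hu.2
      have : w i a ∈ S := by fin_cases a <;> simp [hw]
      exact hind this hu.1 ha
    omega
  · have hU0 : (S ∩ U).card = 0 := by
      rw [Finset.card_eq_zero, Finset.eq_empty_iff_forall_notMem]
      exact fun u hu' => hu ⟨u, hu'⟩
    by_cases hw : ∃ i ∈ D, w i 0 ∈ S ∧ w i 1 ∈ S
    · obtain ⟨i, hi, hw⟩ := hw
      have := hsum1 (D.erase i) (Finset.erase_subset _ _) fun j hj hwj => by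
        obtain ⟨a, b, hab⟩ := hC.wing_adj_wing i hi j (Finset.mem_of_mem_erase hj)
          (Finset.ne_of_mem_erase hj).symm
        have h1 : w i a ∈ S := by fin_cases a <;> simp [hw]
        have h2 : w j b ∈ S := by fin_cases b <;> simp [hwj]
        exact hind h1 h2 ((hab a b).2 ⟨rfl, rfl⟩)
      have h1 := hf2 i hi hw.1
      rw [← Finset.add_sum_erase D f hi] at hcard
      have := Finset.card_erase_add_one hi
      omega
    · have := hsum1 D subset_rfl fun i hi hw' => hw ⟨i, hi, hw'⟩
      omega

/-- The homogenized indicator vector of a finite set. -/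
def homChi (S : Finset V) : Option V → ℝ := homPoint (chi S)

@[simp] theorem homChi_none (S : Finset V) : homChi S none = 1 := rfl
@[simp] theorem homChi_some (S : Finset V) (v : V) :
    homChi S (some v) = if v ∈ S then 1 else 0 := rfl

theorem homChi_insert {S : Finset V} {v : V} (hv : v ∉ S) :
    homChi (insert v S) = Pi.single (some v) 1 + homChi S := by
  ext o
  cases o with
  | none => simp
  | some u =>
    by_cases huv : u = v
    · subst huv; simp [hv]
    · simp [huv]

variable [Fintype V]

open Classical in
/-- The stable sets of a stretched clique with the largest possible number of vertices. -/
noncomputable def tightSets (G : SimpleGraph V) (h : ι → V) (w : ι → Fin 2 → V) (U : Finset V)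
    (D : Finset ι) : Finset (Finset V) :=
  Finset.univ.filter fun S =>
    S ⊆ cliqueSupport h w U D ∧ G.IsIndepSet (S : Set V) ∧ S.card = D.card + 1

theorem homChi_mem_lsCone {G : SimpleGraph V} {S : Finset V} (hS : G.IsIndepSet (S : Set V))
    (k : ℕ) : homChi S ∈ lsCone G k :=
  homPoint_mem_homCone (integerHull_subset_lsPlusIter G k (chi_mem_integerHull hS))

variable {G : SimpleGraph V} {h : ι → V} {w : ι → Fin 2 → V} {U : Finset V} {D : Finset ι}

theorem mem_tightSets {S : Finset V} : S ∈ tightSets G h w U D ↔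
    S ⊆ cliqueSupport h w U D ∧ G.IsIndepSet (S : Set V) ∧ S.card = D.card + 1 := by
  simp [tightSets]

namespace IsStretchedClique

theorem image_hub_card (hC : IsStretchedClique G h w U D) {E : Finset ι} (hE : E ⊆ D) :
    (E.image h).card = E.card :=
  Finset.card_image_of_injOn fun i hi j hj hij => by
    by_contra hne
    exact hC.hub_ne_hub i (hE hi) j (hE hj) hne hij

/-- The source of all tight sets that are needed: the parts outside `E` contribute their hubs, which
conflict with nothing in `U` or in the parts of `E`. -/
theorem mem_tightSets_of (hC : IsStretchedClique G h w U D) {R : Finset V} {E : Finset ι}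
    (hE : E ⊆ D) (hR : ∀ v ∈ R, v ∈ U ∨ ∃ i ∈ E, ∃ a, v = w i a)
    (hind : G.IsIndepSet (R : Set V)) (hcard : R.card = E.card + 1) :
    R ∪ (D \ E).image h ∈ tightSets G h w U D := by
  have hne : ∀ v ∈ R, ∀ j ∈ D \ E, h j ≠ v ∧ ¬ G.Adj (h j) v := by
    intro v hv j hj
    rw [Finset.mem_sdiff] at hj
    rcases hR v hv with hv | ⟨i, hi, a, rfl⟩
    · exact ⟨fun e => hC.hub_notMem j hj.1 (e ▸ hv), hC.hub_not_adj j hj.1 v hv⟩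
    · exact ⟨hC.hub_ne_wing j hj.1 i (hE hi) a,
        hC.hub_not_adj_wing j hj.1 i (hE hi) (fun e => hj.2 (e ▸ hi)) a⟩
  refine mem_tightSets.2 ⟨?_, ?_, ?_⟩
  · intro v hv
    rw [mem_cliqueSupport]
    rcases Finset.mem_union.1 hv with hv | hv
    · rcases hR v hv with hv | ⟨i, hi, a, rfl⟩
      · exact Or.inl hv
      · exact Or.inr ⟨i, hE hi, Or.inr ⟨a, rfl⟩⟩
    · obtain ⟨j, hj, rfl⟩ := Finset.mem_image.1 hv
      exact Or.inr ⟨j, (Finset.mem_sdiff.1 hj).1, Or.inl rfl⟩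
  · intro u hu v hv huv hadj
    rw [Finset.mem_coe, Finset.mem_union, Finset.mem_image] at hu hv
    rcases hu with hu | ⟨i, hi, rfl⟩ <;> rcases hv with hv | ⟨j, hj, rfl⟩
    · exact hind hu hv huv hadj
    · exact (hne u hu j hj).2 hadj.symm
    · exact (hne v hv i hi).2 hadj
    · exact hC.hub_not_adj_hub i (Finset.mem_sdiff.1 hi).1 j (Finset.mem_sdiff.1 hj).1 hadj
  · rw [Finset.card_union_of_disjoint, hcard, hC.image_hub_card Finset.sdiff_subset]
    · have := Finset.card_sdiff_add_card_eq_card hE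
      omega
    · rw [Finset.disjoint_right]
      intro v hv hvR
      obtain ⟨j, hj, rfl⟩ := Finset.mem_image.1 hv
      exact (hne _ hvR j hj).1 rfl

theorem vertex_mem_tightSets (hC : IsStretchedClique G h w U D) {u : V} (hu : u ∈ U) :
    {u} ∪ (D \ ∅).image h ∈ tightSets G h w U D :=
  hC.mem_tightSets_of (Finset.empty_subset _) (by simp [hu]) (by simp) (by simp)

theorem wings_mem_tightSets (hC : IsStretchedClique G h w U D) {i : ι} (hi : i ∈ D) :
    {w i 0, w i 1} ∪ (D \ {i}).image h ∈ tightSets G h w U D := by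
  refine hC.mem_tightSets_of (by simpa using hi) ?_ ?_ ?_
  · intro v hv
    simp only [Finset.mem_insert, Finset.mem_singleton] at hv
    refine Or.inr ⟨i, by simp, ?_⟩
    rcases hv with rfl | rfl <;> exact ⟨_, rfl⟩
  · have := hC.wing_not_adj i hi
    have := hC.wing_not_adj' hi 1 0
    simp [SimpleGraph.isIndepSet_iff, Set.pairwise_insert, *]
  · simp [hC.wing_ne i hi]

theorem homChi_hubs (hC : IsStretchedClique G h w U D) {E : Finset ι} (hE : E ⊆ D) :
    homChi (E.image h) = Pi.single none 1 + ∑ i ∈ E, Pi.single (some (h i)) 1 := by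
  induction E using Finset.induction_on with
  | empty => ext o; cases o <;> simp
  | insert i E hi ih =>
    have hiD := hE (Finset.mem_insert_self i E)
    have hED := (Finset.subset_insert i E).trans hE
    rw [Finset.image_insert, homChi_insert, ih hED, Finset.sum_insert hi]
    · abel
    · rw [Finset.mem_image]
      rintro ⟨j, hj, e⟩
      exact hC.hub_ne_hub j (hED hj) i hiD (fun h => hi (h ▸ hj)) e

/-- The span of the tight stable sets. -/
local notation "tightSpan" => Submodule.span ℝ (homChi '' (tightSets G h w U D : Set (Finset V)))

theorem homChi_union_hubs (hC : IsStretchedClique G h w U D) {R : Finset V} {E : Finset ι}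
    (hE : E ⊆ D) (hR : ∀ v ∈ R, v ∈ U ∨ ∃ i ∈ E, ∃ a, v = w i a) :
    homChi (R ∪ (D \ E).image h) = ∑ v ∈ R, Pi.single (some v) 1 +
      homChi (D.image h) - ∑ i ∈ E, Pi.single (some (h i)) 1 := by
  have h0 : homChi ((D \ E).image h) =
      homChi (D.image h) - ∑ i ∈ E, Pi.single (some (h i)) 1 := by
    rw [hC.homChi_hubs subset_rfl, hC.homChi_hubs Finset.sdiff_subset, ← Finset.sum_sdiff hE]
    abel
  rw [add_sub_assoc, ← h0]
  clear h0
  induction R using Finset.induction_on with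
  | empty => simp
  | insert v R hv ih =>
    rw [Finset.insert_union, homChi_insert, ih fun v hv => hR v (by simp [hv]),
      Finset.sum_insert hv]
    · abel
    · rw [Finset.mem_union, not_or]
      refine ⟨hv, fun hv' => ?_⟩
      obtain ⟨j, hj, rfl⟩ := Finset.mem_image.1 hv'
      rw [Finset.mem_sdiff] at hj
      rcases hR _ (Finset.mem_insert_self _ _) with h | ⟨i, hi, a, h⟩
      · exact hC.hub_notMem j hj.1 h
      · exact hC.hub_ne_wing j hj.1 i (hE hi) a h

theorem add_sub_mem_span (hC : IsStretchedClique G h w U D) {R : Finset V} {E : Finset ι}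
    (hE : E ⊆ D) (hR : ∀ v ∈ R, v ∈ U ∨ ∃ i ∈ E, ∃ a, v = w i a)
    (hind : G.IsIndepSet (R : Set V)) (hcard : R.card = E.card + 1) :
    ∑ v ∈ R, Pi.single (some v) 1 + homChi (D.image h) -
      ∑ i ∈ E, Pi.single (some (h i)) 1 ∈ tightSpan := by
  rw [← hC.homChi_union_hubs hE hR]
  exact Submodule.subset_span ⟨_, hC.mem_tightSets_of hE hR hind hcard, rfl⟩

/-- The missed part supplies a tight set, `{u}` or both wings of `i` completed by hubs, that
contains `h j` and no neighbour of `w j a` except that hub. Exchanging the hub for the wing gives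
another tight set, and the difference is the required vector. -/
theorem wing_sub_hub_mem_span (hC : IsStretchedClique G h w U D) {j : ι} (hj : j ∈ D) {a : Fin 2}
    (hfull : (∃ u ∈ U, ¬ G.Adj (w j a) u) ∨
      ∃ i ∈ D, i ≠ j ∧ ∀ b, ¬ G.Adj (w j a) (w i b)) :
    (Pi.single (some (w j a)) 1 - Pi.single (some (h j)) 1 : Option V → ℝ) ∈ tightSpan := by
  rcases hfull with ⟨u, hu, hadj⟩ | ⟨i, hi, hij, hadj⟩
  · have hne : w j a ≠ u := fun e => hC.wing_notMem j hj a (e ▸ hu)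
    have h1 := hC.add_sub_mem_span (R := {u}) (E := ∅) (by simp) (by simp [hu]) (by simp) (by simp)
    have h2 := hC.add_sub_mem_span (R := {w j a, u}) (E := {j}) (by simpa using hj) (by
        intro v hv
        simp only [Finset.mem_insert, Finset.mem_singleton] at hv
        rcases hv with rfl | rfl
        · exact Or.inr ⟨j, by simp, a, rfl⟩
        · exact Or.inl hu) (by
        have : ¬ G.Adj u (w j a) := fun h => hadj h.symm
        simp [SimpleGraph.isIndepSet_iff, Set.pairwise_insert, *]) (by simp [hne])
    convert Submodule.sub_mem _ h2 h1 using 1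
    simp [Finset.sum_pair hne]
    abel
  · have hne : ∀ b, w j a ≠ w i b := hC.wing_ne_wing j hj i hi hij.symm a
    have hwi := hC.wing_ne i hi
    have hR1 : ∀ v ∈ ({w i 0, w i 1} : Finset V), ∃ b, v = w i b := by
      intro v hv
      simp only [Finset.mem_insert, Finset.mem_singleton] at hv
      rcases hv with rfl | rfl <;> exact ⟨_, rfl⟩
    have hind1 : G.IsIndepSet (({w i 0, w i 1} : Finset V) : Set V) := by
      have := hC.wing_not_adj i hi
      have := hC.wing_not_adj' hi 1 0
      simp [SimpleGraph.isIndepSet_iff, Set.pairwise_insert, *]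
    have h1 := hC.add_sub_mem_span (R := {w i 0, w i 1}) (E := {i}) (by simpa using hi)
      (fun v hv => Or.inr ⟨i, by simp, hR1 v hv⟩) hind1 (by simp [hwi])
    have hnm : w j a ∉ ({w i 0, w i 1} : Finset V) := fun hm => by
      obtain ⟨b, hb⟩ := hR1 _ hm
      exact hne b hb
    have h2 := hC.add_sub_mem_span (R := insert (w j a) {w i 0, w i 1}) (E := {j, i})
      (by simp [Finset.insert_subset_iff, hi, hj]) (by
        intro v hv
        rcases Finset.mem_insert.1 hv with rfl | hv
        · exact Or.inr ⟨j, by simp, a, rfl⟩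
        · exact Or.inr ⟨i, by simp, hR1 v hv⟩) (by
        rw [Finset.coe_insert]
        refine (SimpleGraph.isIndepSet_iff _).2 (Set.Pairwise.insert hind1 fun v hv _ => ?_)
        obtain ⟨b, rfl⟩ := hR1 v hv
        exact ⟨hadj b, fun h => hadj b h.symm⟩) (by
        rw [Finset.card_insert_of_notMem hnm]
        simp [hwi, hij.symm])
    convert Submodule.sub_mem _ h2 h1 using 1
    rw [Finset.sum_insert hnm, Finset.sum_pair hij.symm]
    simp
    abel

/-- If no wing is adjacent to all other parts then the tight stable sets span the vector
`(|D| + 1) (1, χ_hubs) - e₀`. -/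
theorem hub_combination_mem_span (hC : IsStretchedClique G h w U D)
    (hfull : ∀ j ∈ D, ∀ a, (∃ u ∈ U, ¬ G.Adj (w j a) u) ∨
      ∃ i ∈ D, i ≠ j ∧ ∀ b, ¬ G.Adj (w j a) (w i b)) :
    ((D.card + 1 : ℝ) • homChi (D.image h) - Pi.single none 1 : Option V → ℝ) ∈ tightSpan := by
  -- Take the tight set with both wings of `i` and replace each wing by the hub modulo the span: the
  -- hub is then counted twice. Summing over `D` yields the claim, as the extra hub terms add up to
  -- `homChi (D.image h) - e₀`.
  have hterm : ∀ i ∈ D, homChi (D.image h) + Pi.single (some (h i)) 1 ∈ tightSpan := by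
    intro i hi
    have h1 := hC.add_sub_mem_span (R := {w i 0, w i 1}) (E := {i}) (by simpa using hi) (by
        intro v hv
        simp only [Finset.mem_insert, Finset.mem_singleton] at hv
        rcases hv with rfl | rfl <;> exact Or.inr ⟨i, by simp, _, rfl⟩) (by
      have := hC.wing_not_adj i hi
      have := hC.wing_not_adj' hi 1 0
      simp [SimpleGraph.isIndepSet_iff, Set.pairwise_insert, *]) (by simp [hC.wing_ne i hi])
    convert Submodule.sub_mem _ (Submodule.sub_mem _ h1
      (hC.wing_sub_hub_mem_span hi (hfull i hi 0))) (hC.wing_sub_hub_mem_span hi (hfull i hi 1))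
      using 1
    rw [Finset.sum_pair (hC.wing_ne i hi), Finset.sum_singleton]
    abel
  convert Submodule.sum_mem _ hterm using 1
  rw [Finset.sum_add_distrib, Finset.sum_const, hC.homChi_hubs subset_rfl, add_smul, one_smul,
    ← Nat.cast_smul_eq_nsmul ℝ]
  abel

end IsStretchedClique

end StretchedClique

/-- Evaluated at `z`, the identity `hr` expresses `e · z` as `m (p · z)` plus an error controlled by
the `x s · z`. The term in `e` thus supplies about `2m/3 ≥ 4/3` times `ε (p · z)²`, enough to pay
for `-ε (p · z)²`, and the error is absorbed by the first sum through Cauchy–Schwarz. -/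
theorem posSemidef_sum_vecMulVec_perturb {n α : Type*} [Fintype n] (T : Finset α)
    (x : α → n → ℝ) (p e : n → ℝ) {m : ℝ} (hm : 2 ≤ m) (b : α → ℝ)
    (hr : m • p - e = ∑ s ∈ T, b s • x s) {ε : ℝ} (hε : 0 ≤ ε)
    (hεb : ε * (4 / 3 * ∑ s ∈ T, b s ^ 2) ≤ 1) :
    (∑ s ∈ T, vecMulVec (x s) (x s) - ε • vecMulVec p p +
      (ε * (2 / (3 * m))) • vecMulVec e e).PosSemidef := by
  refine .of_dotProduct_mulVec_nonneg ?_ fun z => ?_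
  · ext i j
    simp [vecMulVec_apply, Matrix.sum_apply, mul_comm]
  have hzero : ∀ v : n → ℝ, z ⬝ᵥ (vecMulVec v v *ᵥ z) = (v ⬝ᵥ z) ^ 2 := by
    intro v
    simp [vecMulVec_mulVec, dotProduct_smul, dotProduct_comm z v, sq]
  have hform : star z ⬝ᵥ ((∑ s ∈ T, vecMulVec (x s) (x s) - ε • vecMulVec p p +
      (ε * (2 / (3 * m))) • vecMulVec e e) *ᵥ z) =
      ∑ s ∈ T, (x s ⬝ᵥ z) ^ 2 - ε * (p ⬝ᵥ z) ^ 2 + ε * (2 / (3 * m)) * (e ⬝ᵥ z) ^ 2 := by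
    simp only [star_trivial, add_mulVec, sub_mulVec, sum_mulVec, smul_mulVec, dotProduct_add,
      dotProduct_sub, dotProduct_sum, dotProduct_smul, hzero, smul_eq_mul]
  rw [hform]
  have he : e ⬝ᵥ z = m * (p ⬝ᵥ z) - ∑ s ∈ T, b s * (x s ⬝ᵥ z) := by
    have := congrArg (· ⬝ᵥ z) hr
    simp only [sub_dotProduct, smul_dotProduct, sum_dotProduct, smul_eq_mul] at this
    linarith
  have hcs := Finset.sum_mul_sq_le_sq_mul_sq T b fun s => x s ⬝ᵥ z
  rw [he]
  generalize (∑ s ∈ T, b s * (x s ⬝ᵥ z)) = q at *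
  generalize p ⬝ᵥ z = t at *
  have hQ : 0 ≤ ∑ s ∈ T, (x s ⬝ᵥ z) ^ 2 := Finset.sum_nonneg fun _ _ => sq_nonneg _
  generalize (∑ s ∈ T, (x s ⬝ᵥ z) ^ 2) = Q at *
  generalize (∑ s ∈ T, b s ^ 2) = B at *
  have h1 : 2 / (3 * m) * (m * t - q) ^ 2 =
      2 * m / 3 * t ^ 2 - 4 / 3 * (t * q) + 2 / (3 * m) * q ^ 2 := by field_simp; ring
  -- At `m = 2` the surplus, apart from the `q²` term of `h1`, is `(t - 2q)² / 3`.
  have h2 : -(4 / 3 * q ^ 2) ≤ 2 / (3 * m) * (m * t - q) ^ 2 - t ^ 2 := by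
    have h3 : 0 ≤ 2 / (3 * m) * q ^ 2 := by positivity
    rw [h1]
    nlinarith [sq_nonneg (t - 2 * q), mul_nonneg (sub_nonneg.2 hm) (sq_nonneg t)]
  have h4 : ε * (4 / 3 * q ^ 2) ≤ Q := by
    calc ε * (4 / 3 * q ^ 2) ≤ ε * (4 / 3 * (B * Q)) := by gcongr
      _ = (ε * (4 / 3 * B)) * Q := by ring
      _ ≤ 1 * Q := by gcongr
      _ = Q := one_mul Q
  nlinarith [mul_le_mul_of_nonneg_left h2 hε]

/-! ### Inserting a vertex, and shrinking the perturbation. -/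

section Lifting

variable {V : Type*} [Fintype V] [DecidableEq V] {G : SimpleGraph V}

/-- Setting the coordinate of a vertex `v` to `y₀`, where all neighbours of `v` have coordinate
zero, preserves the `LS₊` relaxations. -/
theorem exists_insert_matrix (v : V) : ∃ A : Matrix (Option V) (Option V) ℝ,
    (∀ S, A *ᵥ homChi S = homChi (insert v S)) ∧
    ∀ k, ∀ y ∈ lsCone G k, (∀ z, G.Adj v z → y (some z) = 0) → A *ᵥ y ∈ lsCone G k := by
  have : Nonempty V := ⟨v⟩
  let A : Matrix (Option V) (Option V) ℝ := fun o =>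
    if o = some v then Pi.single none 1 else Pi.single o 1
  have hA : ∀ y : Option V → ℝ, A *ᵥ y = fun o => if o = some v then y none else y o := by
    intro y
    ext o
    by_cases ho : o = some v <;> simp [A, mulVec, ho]
  refine ⟨A, fun S => ?_, fun k y hy hyz => ?_⟩
  · rw [hA]
    ext o
    cases o with
    | none => simp
    | some u => by_cases huv : u = v <;> simp [huv]
  · refine mulVec_mem_lsCone {z | G.Adj v z} A (by simp [A]) (fun u => ?_) (fun x hx hxz => ?_)
      k hy hyz
    · by_cases huv : u = v
      · exact Or.inr (Or.inl (by simp [A, huv]))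
      · exact Or.inr (Or.inr ⟨u, Or.inl (by simp [A, huv])⟩)
    · rw [hA]
      refine ⟨fun u => ?_, fun u u' hadj => ?_⟩
      · by_cases huv : u = v <;> simp [huv, hx.1]
      · by_cases huv : u = v <;> by_cases huv' : u' = v
        · exact absurd (huv.trans huv'.symm) hadj.ne
        · have := hxz u' (huv ▸ hadj)
          simp [huv, huv', this]
        · have := hxz u (huv' ▸ hadj.symm)
          simp [huv, huv', this]
        · simpa [huv, huv'] using hx.2 u u' hadj

/-- By convexity a gap persists for smaller `ε`, so finitely many gaps can share one `ε`. -/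
theorem sub_smul_mem_lsCone_of_le {k : ℕ} {p q : Option V → ℝ} (hp : p ∈ lsCone G k) {ε δ : ℝ}
    (hε : 0 < ε) (h : p - ε • q ∈ lsCone G k) (hδ : 0 ≤ δ) (hle : δ ≤ ε) :
    p - δ • q ∈ lsCone G k := by
  have h1 : δ / ε ≤ 1 := (div_le_one hε).2 hle
  convert homCone_add (convex_lsPlusIter_fracStab G k) (homCone_smul h (div_nonneg hδ hε.le))
    (homCone_smul hp (sub_nonneg.2 h1)) using 1
  rw [smul_sub, smul_smul, div_mul_cancel₀ _ hε.ne', sub_smul, one_smul]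
  abel

end Lifting

/-! ### The gap vector: removing parts, and the base case. -/

section Gap

variable {V ι : Type*} [Fintype V] [DecidableEq V] [DecidableEq ι] {G : SimpleGraph V}
  {h : ι → V} {w : ι → Fin 2 → V} {U : Finset V} {D : Finset ι} {k : ℕ}

/-- The sum of the homogenized indicator vectors of the tight stable sets. -/
noncomputable def tightSum (G : SimpleGraph V) (h : ι → V) (w : ι → Fin 2 → V) (U : Finset V)
    (D : Finset ι) : Option V → ℝ :=
  ∑ S ∈ tightSets G h w U D, homChi S

/-- The `k`-th relaxation reaches beyond the facet spanned by the tight stable sets, in direction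
of minus the indicator vector of the hubs. -/
def HasGap (G : SimpleGraph V) (h : ι → V) (w : ι → Fin 2 → V) (U : Finset V) (D : Finset ι)
    (k : ℕ) : Prop :=
  ∃ ε : ℝ, 0 < ε ∧ tightSum G h w U D - ε • homChi (D.image h) ∈ lsCone G k

theorem sum_homChi_mem_lsCone {T : Finset (Finset V)} (hT : T ⊆ tightSets G h w U D) :
    ∑ S ∈ T, homChi S ∈ lsCone G k :=
  homCone_sum (convex_lsPlusIter_fracStab G k) (lsPlusIter_fracStab_nonempty G k) _ _
    fun _ hS => homChi_mem_lsCone (mem_tightSets.1 (hT hS)).2.1 k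

theorem HasGap.eventually (hg : HasGap G h w U D k) : ∀ᶠ ε in nhdsWithin (0 : ℝ) (Set.Ioi 0),
    tightSum G h w U D - ε • homChi (D.image h) ∈ lsCone G k := by
  obtain ⟨ε, hε, hmem⟩ := hg
  filter_upwards [Ioo_mem_nhdsGT hε] with δ hδ
  exact sub_smul_mem_lsCone_of_le (sum_homChi_mem_lsCone subset_rfl) hε hmem hδ.1.le hδ.2.le

theorem homChi_eq_zero_of_notMem {S W : Finset V} (hS : S ⊆ W) {v : V} (hv : v ∉ W) :
    homChi S (some v) = 0 := by
  rw [homChi_some, if_neg fun h => hv (hS h)]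

theorem image_hub_subset_cliqueSupport : D.image h ⊆ cliqueSupport h w U D := by
  intro v hv
  obtain ⟨i, hi, rfl⟩ := Finset.mem_image.1 hv
  exact mem_cliqueSupport.2 (Or.inr ⟨i, hi, Or.inl rfl⟩)

/-- Supplies the vanishing coordinates that the inserting and cloning maps require. -/
theorem gap_vector_eq_zero {v : V} (hv : v ∉ cliqueSupport h w U D) (ε : ℝ) :
    (tightSum G h w U D - ε • homChi (D.image h)) (some v) = 0 := by
  have h1 : tightSum G h w U D (some v) = 0 := by
    rw [tightSum, Finset.sum_apply]
    exact Finset.sum_eq_zero fun S hS => homChi_eq_zero_of_notMem (mem_tightSets.1 hS).1 hv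
  rw [Pi.sub_apply, Pi.smul_apply, h1, homChi_eq_zero_of_notMem image_hub_subset_cliqueSupport hv]
  simp

namespace IsStretchedClique

/-- Removing `v` from `U` leaves the bound `|D| + 1` unchanged. The gap vector of the smaller clique
is therefore the part of the sum that avoids `v`, as occurs in `Y (e₀ - e_v)`. -/
theorem tightSets_erase_vertex (hC : IsStretchedClique G h w U D) {v : V} (hv : v ∈ U) :
    tightSets G h w (U.erase v) D = (tightSets G h w U D).filter fun S => v ∉ S := by
  ext S
  rw [Finset.mem_filter, mem_tightSets, mem_tightSets]
  have hsupp : ∀ u, u ∈ cliqueSupport h w (U.erase v) D ↔ u ∈ cliqueSupport h w U D ∧ u ≠ v := by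
    intro u
    simp only [mem_cliqueSupport, Finset.mem_erase]
    constructor
    · rintro (⟨h1, h2⟩ | ⟨i, hi, h1⟩)
      · exact ⟨Or.inl h2, h1⟩
      · refine ⟨Or.inr ⟨i, hi, h1⟩, ?_⟩
        rintro rfl
        rcases h1 with h1 | ⟨a, h1⟩
        · exact hC.hub_notMem i hi (h1 ▸ hv)
        · exact hC.wing_notMem i hi a (h1 ▸ hv)
    · rintro ⟨h1 | h1, h2⟩
      · exact Or.inl ⟨h2, h1⟩
      · exact Or.inr h1
  have : S ⊆ cliqueSupport h w (U.erase v) D ↔ S ⊆ cliqueSupport h w U D ∧ v ∉ S := by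
    constructor
    · exact fun hS => ⟨fun u hu => ((hsupp u).1 (hS hu)).1, fun hvS => ((hsupp v).1 (hS hvS)).2 rfl⟩
    · exact fun hS u hu => (hsupp u).2 ⟨hS.1 hu, fun e => hS.2 (e ▸ hu)⟩
  rw [this]
  tauto

theorem insert_hub_mem_tightSets (hC : IsStretchedClique G h w U D) {i : ι} (hi : i ∈ D)
    {S : Finset V} (hS : S ∈ tightSets G h w U (D.erase i)) :
    h i ∉ S ∧ insert (h i) S ∈ tightSets G h w U D := by
  obtain ⟨h1, h2, h3⟩ := mem_tightSets.1 hS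
  have hne : ∀ v ∈ S, v ≠ h i ∧ ¬ G.Adj (h i) v := by
    intro v hv
    rcases mem_cliqueSupport.1 (h1 hv) with hv | ⟨j, hj, rfl | ⟨a, rfl⟩⟩
    · exact ⟨fun e => hC.hub_notMem i hi (e ▸ hv), hC.hub_not_adj i hi v hv⟩
    · exact ⟨hC.hub_ne_hub j (Finset.mem_of_mem_erase hj) i hi (Finset.ne_of_mem_erase hj),
        hC.hub_not_adj_hub i hi j (Finset.mem_of_mem_erase hj)⟩
    · exact ⟨(hC.hub_ne_wing i hi j (Finset.mem_of_mem_erase hj) a).symm,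
        hC.hub_not_adj_wing i hi j (Finset.mem_of_mem_erase hj) (Finset.ne_of_mem_erase hj).symm a⟩
  have hiS : h i ∉ S := fun hm => (hne _ hm).1 rfl
  refine ⟨hiS, mem_tightSets.2 ⟨?_, ?_, ?_⟩⟩
  · refine Finset.insert_subset (mem_cliqueSupport.2 (Or.inr ⟨i, hi, Or.inl rfl⟩)) ?_
    exact h1.trans (cliqueSupport_mono subset_rfl (Finset.erase_subset _ _))
  · rw [Finset.coe_insert]
    exact (SimpleGraph.isIndepSet_iff _).2 (Set.Pairwise.insert h2 fun v hv _ =>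
      ⟨(hne v hv).2, fun e => (hne v hv).2 e.symm⟩)
  · rw [Finset.card_insert_of_notMem hiS, h3, Finset.card_erase_add_one hi]

theorem erase_hub_mem_tightSets (hC : IsStretchedClique G h w U D) {i : ι} (hi : i ∈ D)
    {S : Finset V} (hS : S ∈ tightSets G h w U D) (hiS : h i ∈ S) :
    S.erase (h i) ∈ tightSets G h w U (D.erase i) := by
  obtain ⟨h1, h2, h3⟩ := mem_tightSets.1 hS
  refine mem_tightSets.2 ⟨?_, h2.mono (by simp), ?_⟩
  · intro v hv
    rw [Finset.mem_erase] at hv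
    rw [mem_cliqueSupport]
    rcases mem_cliqueSupport.1 (h1 hv.2) with hv' | ⟨j, hj, hv'⟩
    · exact Or.inl hv'
    · refine Or.inr ⟨j, Finset.mem_erase.2 ⟨?_, hj⟩, hv'⟩
      rintro rfl
      rcases hv' with rfl | ⟨a, rfl⟩
      · exact hv.1 rfl
      · exact h2 hiS hv.2 hv.1.symm (hC.hub_adj_wing j hj a)
  · rw [Finset.card_erase_of_mem hiS, h3]
    have := Finset.card_erase_add_one hi
    omega

/-- Adding the hub `h i` is a bijection from the tight sets without part `i` to the tight sets
containing `h i`, and it completes the set of hubs. The insertion map thus carries the smaller gap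
vector to this one. -/
theorem sum_hub_sub_mem_lsCone (hC : IsStretchedClique G h w U D) {i : ι} (hi : i ∈ D) {ε : ℝ}
    (hg : tightSum G h w U (D.erase i) - ε • homChi ((D.erase i).image h) ∈ lsCone G k) :
    ∑ S ∈ (tightSets G h w U D).filter (fun S => h i ∈ S), homChi S -
      ε • homChi (D.image h) ∈ lsCone G k := by
  obtain ⟨A, hA, hAmem⟩ := exists_insert_matrix (G := G) (h i)
  convert hAmem k _ hg fun z hz => gap_vector_eq_zero (fun hz' => ?_) ε using 1
  · rw [mulVec_sub, mulVec_smul, hA, ← Finset.image_insert, Finset.insert_erase hi, tightSum,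
      mulVec_sum]
    congr 1
    symm
    refine Finset.sum_nbij' (insert (h i)) (fun S => S.erase (h i)) ?_ ?_ ?_ ?_ ?_
    · intro S hS
      exact Finset.mem_filter.2 ⟨(hC.insert_hub_mem_tightSets hi hS).2, by simp⟩
    · intro S hS
      rw [Finset.mem_filter] at hS
      exact hC.erase_hub_mem_tightSets hi hS.1 hS.2
    · intro S hS
      exact Finset.erase_insert (hC.insert_hub_mem_tightSets hi hS).1
    · intro S hS
      exact Finset.insert_erase (Finset.mem_filter.1 hS).2
    · intro S _
      exact hA S
  · rcases mem_cliqueSupport.1 hz' with hz' | ⟨j, hj, rfl | ⟨a, rfl⟩⟩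
    · exact hC.hub_not_adj i hi z hz' hz
    · exact hC.hub_not_adj_hub i hi j (Finset.mem_of_mem_erase hj) hz
    · exact hC.hub_not_adj_wing i hi j (Finset.mem_of_mem_erase hj)
        (Finset.ne_of_mem_erase hj).symm a hz

theorem exists_tight_notMem (hC : IsStretchedClique G h w U D) (hcard : 3 ≤ U.card + D.card)
    {u v : V} (hu : u ∉ D.image h) (hv : v ∉ D.image h) :
    ∃ S ∈ tightSets G h w U D, u ∉ S ∧ v ∉ S := by
  have key : ∀ v, v ∉ D.image h → ∃ (A : Finset V) (B : Finset ι), A.card + B.card ≤ 1 ∧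
      (∀ x ∈ U, x ∉ A → v ∉ {x} ∪ (D \ ∅).image h) ∧
      (∀ i ∈ D, i ∉ B → v ∉ {w i 0, w i 1} ∪ (D \ {i}).image h) := by
    intro v hv
    have hv' : ∀ E, v ∉ (D \ E).image h := fun E hE =>
      hv (Finset.image_subset_image Finset.sdiff_subset hE)
    simp only [Finset.mem_union, hv', or_false, Finset.mem_insert, Finset.mem_singleton]
    by_cases hvU : v ∈ U
    · refine ⟨{v}, ∅, by simp, fun x _ hx e => hx (by simp [e]), fun i hi _ e => ?_⟩
      rcases e with rfl | rfl
      · exact hC.wing_notMem i hi _ hvU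
      · exact hC.wing_notMem i hi _ hvU
    by_cases hvD : ∃ i ∈ D, ∃ a, v = w i a
    · obtain ⟨i, hi, a, rfl⟩ := hvD
      refine ⟨∅, {i}, by simp, fun x hx _ e => hvU (e ▸ hx), fun j hj hij e => ?_⟩
      have hij' : i ≠ j := fun e => hij (by simp [e])
      rcases e with e | e
      · exact hC.wing_ne_wing i hi j hj hij' _ _ e
      · exact hC.wing_ne_wing i hi j hj hij' _ _ e
    · refine ⟨∅, ∅, by simp, fun x hx _ e => hvU (e ▸ hx), fun i hi _ e => hvD ?_⟩
      rcases e with e | e <;> exact ⟨i, hi, _, e⟩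
  obtain ⟨A, B, hAB, hA, hB⟩ := key u hu
  obtain ⟨A', B', hAB', hA', hB'⟩ := key v hv
  -- Each of `u` and `v` excludes at most one of the `|U| + |D| ≥ 3` standard tight sets, so one
  -- remains.
  have h1 := Finset.le_card_sdiff (A ∪ A') U
  have h2 := Finset.le_card_sdiff (B ∪ B') D
  have h3 := Finset.card_union_le A A'
  have h4 := Finset.card_union_le B B'
  have h5 : 0 < (U \ (A ∪ A')).card ∨ 0 < (D \ (B ∪ B')).card := by omega
  rcases h5 with h5 | h5
  · obtain ⟨x, hx⟩ := Finset.card_pos.1 h5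
    simp only [Finset.mem_sdiff, Finset.mem_union, not_or] at hx
    exact ⟨_, hC.vertex_mem_tightSets hx.1, hA x hx.1 hx.2.1, hA' x hx.1 hx.2.2⟩
  · obtain ⟨i, hi⟩ := Finset.card_pos.1 h5
    simp only [Finset.mem_sdiff, Finset.mem_union, not_or] at hi
    exact ⟨_, hC.wings_mem_tightSets hi.1, hB i hi.1 hi.2.1, hB' i hi.1 hi.2.2⟩

theorem exists_tight_hub_mem (hC : IsStretchedClique G h w U D) (hcard : 3 ≤ U.card + D.card)
    {i : ι} (hi : i ∈ D) : ∃ S ∈ tightSets G h w U D, h i ∈ S := by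
  have h5 : 0 < U.card ∨ 0 < (D.erase i).card := by
    have := Finset.card_erase_add_one hi
    omega
  rcases h5 with h5 | h5
  · obtain ⟨x, hx⟩ := Finset.card_pos.1 h5
    exact ⟨_, hC.vertex_mem_tightSets hx, Finset.mem_union_right _
      (Finset.mem_image_of_mem h (by simpa using hi))⟩
  · obtain ⟨j, hj⟩ := Finset.card_pos.1 h5
    rw [Finset.mem_erase] at hj
    exact ⟨_, hC.wings_mem_tightSets hj.2, Finset.mem_union_right _
      (Finset.mem_image_of_mem h (by simpa [hi] using hj.1.symm))⟩

theorem tightSets_nonempty (hC : IsStretchedClique G h w U D) (hcard : 3 ≤ U.card + D.card) :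
    (tightSets G h w U D).Nonempty := by
  have h5 : 0 < U.card ∨ 0 < D.card := by omega
  rcases h5 with h5 | h5
  · obtain ⟨x, hx⟩ := Finset.card_pos.1 h5
    exact ⟨_, hC.vertex_mem_tightSets hx⟩
  · obtain ⟨i, hi⟩ := Finset.card_pos.1 h5
    exact ⟨_, hC.wings_mem_tightSets hi⟩

/-- Every defining inequality that the perturbation could hurt has slack at least 1 at the sum of
the tight vectors, since some tight set satisfies it strictly and the slacks are integers. An
inequality involving a hub loses no more on its right side than on its left. -/
theorem hasGap_zero (hC : IsStretchedClique G h w U D) (hcard : 3 ≤ U.card + D.card) :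
    HasGap G h w U D 0 := by
  set T := tightSets G h w U D with hT
  have hind : ∀ S ∈ T, ∀ u v, G.Adj u v →
      0 ≤ 1 - homChi S (some u) - homChi S (some v) := by
    intro S hS u v hadj
    have : ¬ (u ∈ S ∧ v ∈ S) := fun ⟨hu, hv⟩ =>
      (mem_tightSets.1 hS).2.1 hu hv hadj.ne hadj
    simp only [homChi_some]
    split_ifs <;> simp_all
  have h01 : ∀ (S : Finset V) v, 0 ≤ homChi S (some v) ∧ 0 ≤ 1 - homChi S (some v) := by
    intro S v
    simp only [homChi_some]
    split_ifs <;> simp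
  have hsum : ∀ f : Finset V → ℝ, (∀ S ∈ T, 0 ≤ f S) → (∃ S ∈ T, f S = 1) →
      1 ≤ ∑ S ∈ T, f S := by
    rintro f hf ⟨S, hS, h1⟩
    exact h1 ▸ Finset.single_le_sum hf hS
  have hp0 : tightSum G h w U D none = ∑ S ∈ T, (1 : ℝ) := by simp [tightSum, hT]
  have hpv : ∀ v, tightSum G h w U D (some v) = ∑ S ∈ T, homChi S (some v) := fun v => by
    rw [tightSum, Finset.sum_apply]
  set p := tightSum G h w U D
  have hp1 : 1 ≤ p none := by
    obtain ⟨S, hS⟩ := hC.tightSets_nonempty hcard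
    rw [hp0]
    exact hsum _ (fun _ _ => zero_le_one) ⟨S, hS, rfl⟩
  have hpnn : ∀ v, 0 ≤ p (some v) := fun v => by
    rw [hpv]; exact Finset.sum_nonneg fun S _ => (h01 S v).1
  have hple : ∀ v, p (some v) ≤ p none := fun v => by
    rw [hpv, hp0]; exact Finset.sum_le_sum fun S _ => by linarith [(h01 S v).2]
  have hple' : ∀ v, v ∉ D.image h → p (some v) + 1 ≤ p none := fun v hv => by
    obtain ⟨S, hS, hvS, -⟩ := hC.exists_tight_notMem hcard hv hv
    have := hsum (fun S => 1 - homChi S (some v)) (fun S _ => (h01 S v).2) ⟨S, hS, by simp [hvS]⟩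
    rw [Finset.sum_sub_distrib, ← hp0, ← hpv] at this
    linarith
  have hpadj : ∀ u v, G.Adj u v → p (some u) + p (some v) ≤ p none := fun u v hadj => by
    have := Finset.sum_nonneg (s := T) fun S hS => hind S hS u v hadj
    rw [Finset.sum_sub_distrib, Finset.sum_sub_distrib, ← hp0, ← hpv, ← hpv] at this
    linarith
  have hpadj' : ∀ u v, G.Adj u v → u ∉ D.image h → v ∉ D.image h →
      p (some u) + p (some v) + 1 ≤ p none := fun u v hadj hu hv => by
    obtain ⟨S, hS, huS, hvS⟩ := hC.exists_tight_notMem hcard hu hv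
    have := hsum (fun S => 1 - homChi S (some u) - homChi S (some v))
      (fun S hS => hind S hS u v hadj) ⟨S, hS, by simp [huS, hvS]⟩
    rw [Finset.sum_sub_distrib, Finset.sum_sub_distrib, ← hp0, ← hpv, ← hpv] at this
    linarith
  have hphub : ∀ v ∈ D.image h, 1 ≤ p (some v) := fun v hv => by
    obtain ⟨i, hi, rfl⟩ := Finset.mem_image.1 hv
    obtain ⟨S, hS, hiS⟩ := hC.exists_tight_hub_mem hcard hi
    rw [hpv]
    exact hsum _ (fun S _ => (h01 S _).1) ⟨S, hS, by simp [hiS]⟩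
  refine ⟨1 / 2, by norm_num, (?_ : p - (1 / 2 : ℝ) • homChi (D.image h) ∈ lsCone G 0)⟩
  have hy0 : (p - (1 / 2 : ℝ) • homChi (D.image h)) none = p none - 1 / 2 := by simp
  have hyv : ∀ v, (p - (1 / 2 : ℝ) • homChi (D.image h)) (some v) =
      p (some v) - if v ∈ D.image h then 1 / 2 else 0 := fun v => by
    simp only [Pi.sub_apply, Pi.smul_apply, homChi_some, smul_eq_mul]
    split_ifs <;> norm_num
  have hpos : 0 < p none - 1 / 2 := by linarith
  refine mem_homCone_of_pos (by rw [hy0]; exact hpos) ⟨fun v => ?_, fun u v hadj => ?_⟩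
  · simp only [hy0, hyv]
    refine ⟨div_nonneg ?_ hpos.le, (div_le_one hpos).2 ?_⟩
    · split_ifs with hv
      · linarith [hphub v hv]
      · linarith [hpnn v]
    · split_ifs with hv
      · linarith [hple v]
      · linarith [hple' v hv]
  · simp only [hy0, hyv]
    rw [← add_div, div_le_one hpos]
    have := hpadj u v hadj
    split_ifs with hu hv hv
    · linarith
    · linarith
    · linarith
    · linarith [hpadj' u v hadj hu hv]

end IsStretchedClique

end Gap

/-! ### Replacing a stretched vertex by a full wing. -/

section FullWing

variable {V ι : Type*} [Fintype V] [DecidableEq V] [DecidableEq ι] {G : SimpleGraph V}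
  {h : ι → V} {w : ι → Fin 2 → V} {U : Finset V} {D : Finset ι} {k : ℕ}

/-- Setting the coordinate of `q` to `y₀ - y_c` and that of `b` to `y_c` preserves the `LS₊`
relaxations on the vectors supported on `W`, if all neighbours of `q` in `W` equal `c` and all
neighbours of `b` in `W` are neighbours of `c`. -/
theorem exists_clone_matrix {c q b : V} {W : Finset V} (hq : q ∉ W) (hb : b ∉ W) (hc : c ∈ W)
    (hqb : q ≠ b) (hqW : ∀ v ∈ W, G.Adj q v → v = c) (hbW : ∀ v ∈ W, G.Adj b v → G.Adj c v) :
    ∃ A : Matrix (Option V) (Option V) ℝ,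
    (∀ S ⊆ W, A *ᵥ homChi S = homChi (insert (if c ∈ S then b else q) S)) ∧
    ∀ k, ∀ y ∈ lsCone G k, (∀ z ∉ W, y (some z) = 0) → A *ᵥ y ∈ lsCone G k := by
  have : Nonempty V := ⟨c⟩
  have hcq : c ≠ q := fun e => hq (e ▸ hc)
  have hcb : c ≠ b := fun e => hb (e ▸ hc)
  let A : Matrix (Option V) (Option V) ℝ := fun o =>
    if o = some q then Pi.single none 1 - Pi.single (some c) 1
    else if o = some b then Pi.single (some c) 1 else Pi.single o 1
  have hA : ∀ y : Option V → ℝ, A *ᵥ y = fun o =>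
      if o = some q then y none - y (some c) else if o = some b then y (some c) else y o := by
    intro y
    ext o
    by_cases hoq : o = some q
    · simp only [A, mulVec, hoq, if_true]
      change (Pi.single none 1 - Pi.single (some c) 1 : Option V → ℝ) ⬝ᵥ y = _
      simp [sub_dotProduct]
    · by_cases hob : o = some b
      · simp [A, mulVec, hob, hqb.symm]
      · simp [A, mulVec, hoq, hob]
  refine ⟨A, fun S hS => ?_, fun k y hy hyz => ?_⟩
  · rw [hA]
    ext o
    cases o with
    | none => simp
    | some u =>
      have hqS : q ∉ S := fun e => hq (hS e)
      have hbS : b ∉ S := fun e => hb (hS e)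
      by_cases hcS : c ∈ S
      · by_cases huq : u = q
        · subst huq; simp [hcS, hqS, hqb]
        · by_cases hub : u = b <;> simp [huq, hub, hcS, hqb.symm]
      · by_cases huq : u = q
        · subst huq; simp [hcS]
        · by_cases hub : u = b
          · subst hub; simp [hcS, hbS, huq]
          · simp [huq, hub, hcS]
  · refine mulVec_mem_lsCone {z | z ∉ W} A (by simp [A]) (fun u => ?_) (fun x hx hxz => ?_)
      k hy hyz
    · by_cases huq : u = q
      · exact Or.inr (Or.inr ⟨c, Or.inr (by simp [A, huq])⟩)
      · by_cases hub : u = b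
        · exact Or.inr (Or.inr ⟨c, Or.inl (by simp [A, hub, hqb.symm])⟩)
        · exact Or.inr (Or.inr ⟨u, Or.inl (by simp [A, huq, hub])⟩)
    · rw [hA]
      have hxc := hx.1 c
      have hval : ∀ u, (if (some u : Option V) = some q then homPoint x none - homPoint x (some c)
          else if (some u : Option V) = some b then homPoint x (some c) else homPoint x (some u)) =
          if u = q then 1 - x c else if u = b then x c else x u := by
        intro u; simp
      simp only [hval]
      -- The new coordinate of `q` is `1 - x c`, so its edge inequalities say that its neighbours
      -- are at most `x c`.
      have hqn : ∀ u, G.Adj q u → (if u = b then x c else x u) ≤ x c := by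
        intro u hadj
        split_ifs
        · exact le_rfl
        · by_cases huW : u ∈ W
          · rw [hqW u huW hadj]
          · rw [hxz u huW]; exact hxc.1
      have hbn : ∀ u, G.Adj b u → x u + x c ≤ 1 := by
        intro u hadj
        by_cases huW : u ∈ W
        · have := hx.2 c u (hbW u huW hadj)
          linarith
        · rw [hxz u huW]; linarith
      refine ⟨fun u => ?_, fun u u' hadj => ?_⟩ <;> dsimp only
      · have := hx.1 u
        split_ifs
        · constructor <;> linarith
        · exact hxc
        · exact this
      · by_cases huq : u = q
        · subst huq
          rw [if_pos rfl, if_neg hadj.ne']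
          linarith [hqn u' hadj]
        · by_cases huq' : u' = q
          · subst huq'
            rw [if_pos rfl, if_neg hadj.ne]
            linarith [hqn u hadj.symm]
          · rw [if_neg huq, if_neg huq']
            by_cases hub : u = b
            · subst hub
              rw [if_pos rfl, if_neg hadj.ne']
              linarith [hbn u' hadj]
            · by_cases hub' : u' = b
              · subst hub'
                rw [if_pos rfl, if_neg hadj.ne]
                linarith [hbn u hadj.symm]
              · rw [if_neg hub, if_neg hub']
                exact hx.2 u u' hadj

namespace IsStretchedClique

/-- With `c = w j a` moved into the clique, the hub receives the coordinate `y₀ - y_c` and the other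
wing a copy of `y_c`. Tight sets map injectively to tight sets and hub indicator to hub indicator;
the tight sets that are missed are added by convexity. -/
theorem hasGap_of_full (hC : IsStretchedClique G h w U D) {j : ι} (hj : j ∈ D) {a : Fin 2}
    (hU : ∀ u ∈ U, G.Adj (w j a) u) (hD : ∀ i ∈ D, i ≠ j → ∃ b, G.Adj (w j a) (w i b))
    (hg : HasGap G h w (insert (w j a) U) (D.erase j) k) : HasGap G h w U D k := by
  obtain ⟨b, hba, hbr⟩ : ∃ b : Fin 2, b ≠ a ∧ ∀ c, c = a ∨ c = b := by
    clear hU hD hg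
    revert a; decide
  set W := cliqueSupport h w (insert (w j a) U) (D.erase j) with hW
  have hmem : ∀ v, v ∈ W ↔ v = w j a ∨ v ∈ U ∨ ∃ i ∈ D, i ≠ j ∧ (v = h i ∨ ∃ c, v = w i c) := by
    intro v
    rw [hW, mem_cliqueSupport, Finset.mem_insert, or_assoc]
    simp only [Finset.mem_erase, and_assoc]
    constructor
    · rintro (h | h | ⟨i, h1, h2, h3⟩)
      exacts [Or.inl h, Or.inr (Or.inl h), Or.inr (Or.inr ⟨i, h2, h1, h3⟩)]
    · rintro (h | h | ⟨i, h1, h2, h3⟩)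
      exacts [Or.inl h, Or.inr (Or.inl h), Or.inr (Or.inr ⟨i, h2, h1, h3⟩)]
  have hcW : w j a ∈ W := (hmem _).2 (Or.inl rfl)
  have hqW : h j ∉ W := by
    rw [hmem]
    rintro (e | e | ⟨i, hi, hij, e | ⟨c, e⟩⟩)
    · exact hC.hub_ne_wing j hj j hj a e
    · exact hC.hub_notMem j hj e
    · exact hC.hub_ne_hub i hi j hj hij e.symm
    · exact hC.hub_ne_wing j hj i hi c e
  have hbW : w j b ∉ W := by
    rw [hmem]
    rintro (e | e | ⟨i, hi, hij, e | ⟨c, e⟩⟩)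
    · exact hC.wing_injective hj hba e
    · exact hC.wing_notMem j hj b e
    · exact hC.hub_ne_wing i hi j hj b e.symm
    · exact hC.wing_ne_wing i hi j hj hij c b e.symm
  have hqadj : ∀ v ∈ W, G.Adj (h j) v → v = w j a := by
    intro v hv hadj
    rcases (hmem v).1 hv with e | e | ⟨i, hi, hij, rfl | ⟨c, rfl⟩⟩
    · exact e
    · exact absurd hadj (hC.hub_not_adj j hj v e)
    · exact absurd hadj (hC.hub_not_adj_hub j hj i hi)
    · exact absurd hadj (hC.hub_not_adj_wing j hj i hi hij.symm c)
  have hbadj : ∀ v ∈ W, G.Adj (w j b) v → v ∈ U := by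
    intro v hv hadj
    rcases (hmem v).1 hv with rfl | e | ⟨i, hi, hij, rfl | ⟨c, rfl⟩⟩
    · exact absurd hadj (hC.wing_not_adj' hj b a)
    · exact e
    · exact absurd hadj.symm (hC.hub_not_adj_wing i hi j hj hij b)
    -- The only edge between the wings of `j` and of `i` is already used by the full wing, so the
    -- other wing sees no wing of `i`.
    · obtain ⟨d, hd⟩ := hD i hi hij
      obtain ⟨x, y, hxy⟩ := hC.wing_adj_wing j hj i hi hij.symm
      exact absurd (((hxy b c).1 hadj).1.trans ((hxy a d).1 hd).1.symm) hba
  obtain ⟨A, hA, hAmem⟩ := exists_clone_matrix hqW hbW hcW (hC.hub_ne_wing j hj j hj b) hqadj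
    fun v hv hadj => hU v (hbadj v hv hadj)
  let φ : Finset V → Finset V := fun S => insert (if w j a ∈ S then w j b else h j) S
  have hφT : ∀ S ∈ tightSets G h w (insert (w j a) U) (D.erase j),
      φ S ∈ tightSets G h w U D := by
    intro S hS
    obtain ⟨h1, h2, h3⟩ := mem_tightSets.1 hS
    have hnm : (if w j a ∈ S then w j b else h j) ∉ S := by
      split_ifs
      · exact fun e => hbW (h1 e)
      · exact fun e => hqW (h1 e)
    have hnadj : ∀ v ∈ S, ¬ G.Adj (if w j a ∈ S then w j b else h j) v := by
      intro v hv hadj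
      split_ifs at hadj with hc
      · have hvU := hbadj v (h1 hv) hadj
        exact h2 hc hv (hU v hvU).ne (hU v hvU)
      · exact hc (hqadj v (h1 hv) hadj ▸ hv)
    refine mem_tightSets.2 ⟨?_, ?_, ?_⟩
    · refine Finset.insert_subset ?_ fun v hv => ?_
      · rw [mem_cliqueSupport]
        split_ifs
        · exact Or.inr ⟨j, hj, Or.inr ⟨b, rfl⟩⟩
        · exact Or.inr ⟨j, hj, Or.inl rfl⟩
      · rw [mem_cliqueSupport]
        rcases (hmem v).1 (h1 hv) with e | e | ⟨i, hi, -, e⟩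
        · exact Or.inr ⟨j, hj, Or.inr ⟨a, e⟩⟩
        · exact Or.inl e
        · exact Or.inr ⟨i, hi, e⟩
    · simp only [φ]
      rw [Finset.coe_insert]
      exact (SimpleGraph.isIndepSet_iff _).2 (Set.Pairwise.insert h2 fun v hv _ =>
        ⟨hnadj v hv, fun e => hnadj v hv e.symm⟩)
    · rw [Finset.card_insert_of_notMem hnm, h3, Finset.card_erase_add_one hj]
  have hφinj : Set.InjOn φ (tightSets G h w (insert (w j a) U) (D.erase j) : Set (Finset V)) := by
    -- The inserted vertex lies outside `W`, so intersecting with `W` recovers the original set.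
    have hinv : ∀ S ∈ tightSets G h w (insert (w j a) U) (D.erase j), φ S ∩ W = S := by
      intro S hS
      obtain ⟨h1, -, -⟩ := mem_tightSets.1 hS
      simp only [φ]
      rw [Finset.insert_inter_of_notMem, Finset.inter_eq_left.2 h1]
      split_ifs
      · exact hbW
      · exact hqW
    intro S hS S' hS' e
    rw [← hinv S hS, ← hinv S' hS', e]
  obtain ⟨ε, hε, hmemε⟩ := hg
  refine ⟨ε, hε, ?_⟩
  have hlift := hAmem k _ hmemε fun z hz => gap_vector_eq_zero hz ε
  have hhub : A *ᵥ homChi ((D.erase j).image h) = homChi (D.image h) := by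
    rw [hA _ image_hub_subset_cliqueSupport, if_neg, ← Finset.image_insert, Finset.insert_erase hj]
    intro e
    obtain ⟨i, hi, e⟩ := Finset.mem_image.1 e
    exact hC.hub_ne_wing i (Finset.mem_of_mem_erase hi) j hj a e
  have hsum : A *ᵥ tightSum G h w (insert (w j a) U) (D.erase j) =
      ∑ S ∈ (tightSets G h w (insert (w j a) U) (D.erase j)).image φ, homChi S := by
    rw [tightSum, mulVec_sum, Finset.sum_image hφinj]
    exact Finset.sum_congr rfl fun S hS => hA S (mem_tightSets.1 hS).1
  have hsub : (tightSets G h w (insert (w j a) U) (D.erase j)).image φ ⊆ tightSets G h w U D := by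
    intro S hS
    obtain ⟨S', hS', rfl⟩ := Finset.mem_image.1 hS
    exact hφT S' hS'
  convert homCone_add (convex_lsPlusIter_fracStab G k) hlift (sum_homChi_mem_lsCone
    (Finset.sdiff_subset (s := tightSets G h w U D)
      (t := (tightSets G h w (insert (w j a) U) (D.erase j)).image φ))) using 1
  rw [mulVec_sub, mulVec_smul, hhub, hsum, tightSum, ← Finset.sum_sdiff hsub]
  abel

end IsStretchedClique

end FullWing

/-! ### From level `k` to level `k + 1`, and the resulting rank. -/

section GapStep

variable {V ι : Type*} [Fintype V] [DecidableEq V] [DecidableEq ι] {G : SimpleGraph V}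
  {h : ι → V} {w : ι → Fin 2 → V} {U : Finset V} {D : Finset ι} {k : ℕ}

theorem empty_homChi_mem_lsCone : homChi ∅ ∈ lsCone G k := homChi_mem_lsCone (by simp) k

theorem homChi_empty : homChi (∅ : Finset V) = Pi.single none 1 := by
  ext o; cases o <;> simp

namespace IsStretchedClique

/-- In the column of a hub the perturbation `-ε p` falls into `Y e_v`; for every other vertex it
falls into `Y (e₀ - e_v)`. In each case a smaller clique's gap absorbs it, and the remaining terms
are nonnegative combinations of stable sets. -/
theorem exists_gap_matrix (hC : IsStretchedClique G h w U D) (hD : D.Nonempty)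
    (hcard : 3 ≤ U.card + D.card) {b : Finset V → ℝ}
    (hb : (D.card + 1 : ℝ) • homChi (D.image h) - homChi ∅ =
      ∑ S ∈ tightSets G h w U D, b S • homChi S)
    (hgU : ∀ v ∈ U, HasGap G h w (U.erase v) D k)
    (hgD : ∀ i ∈ D, HasGap G h w U (D.erase i) k) :
    ∃ ε : ℝ, 0 < ε ∧ tightSum G h w U D - ε • homChi (D.image h) +
      (ε * (2 / (3 * (D.card + 1)))) • homChi ∅ ∈ lsCone G (k + 1) := by
  set T := tightSets G h w U D with hT
  set p := homChi (D.image h) with hp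
  have hm : (2 : ℝ) ≤ D.card + 1 := by
    have : (1 : ℝ) ≤ D.card := by exact_mod_cast hD.card_pos
    linarith
  have hconv := convex_lsPlusIter_fracStab G k
  have hB : 0 ≤ ∑ S ∈ T, b S ^ 2 := Finset.sum_nonneg fun _ _ => sq_nonneg _
  have hev : ∀ᶠ ε in nhdsWithin (0 : ℝ) (Set.Ioi 0), 0 < ε ∧ ε < 1 ∧
      ε * (4 / 3 * ∑ S ∈ T, b S ^ 2) ≤ 1 ∧
      (∀ v ∈ U, tightSum G h w (U.erase v) D - ε • p ∈ lsCone G k) ∧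
      ∀ i ∈ D, tightSum G h w U (D.erase i) - ε • homChi ((D.erase i).image h) ∈ lsCone G k := by
    have h1 : (0 : ℝ) < 1 / (1 + 4 / 3 * ∑ S ∈ T, b S ^ 2) := by positivity
    filter_upwards [Ioo_mem_nhdsGT zero_lt_one, Ioo_mem_nhdsGT h1,
      (Finset.eventually_all U).2 fun v hv => (hgU v hv).eventually,
      (Finset.eventually_all D).2 fun i hi => (hgD i hi).eventually] with ε hε1 hε2 hε3 hε4
    refine ⟨hε1.1, hε1.2, ?_, hε3, hε4⟩
    have := (lt_div_iff₀ (by positivity)).1 hε2.2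
    nlinarith [hε1.1]
  obtain ⟨ε, hε0, hε1, hεb, hεU, hεD⟩ := hev.exists
  refine ⟨ε, hε0, ?_⟩
  -- With `m = |D| + 1`, semidefiniteness needs `c m²` to exceed `ε`, while the gap at the next
  -- level needs `c m < ε`. Here `c m = 2ε/3` and `m ≥ 2`.
  set c := ε * (2 / (3 * (D.card + 1 : ℝ))) with hc
  have hc0 : 0 < c := by positivity
  set Y := ∑ S ∈ T, vecMulVec (homChi S) (homChi S) - ε • vecMulVec p p +
    c • vecMulVec (homChi ∅) (homChi (∅ : Finset V)) with hYdef
  have hpsd : Y.PosSemidef :=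
    posSemidef_sum_vecMulVec_perturb T homChi p (homChi ∅) hm b hb hε0.le hεb
  have hYab : ∀ x y, Y x y = ∑ S ∈ T, homChi S x * homChi S y - ε * (p x * p y) +
      c * (homChi (∅ : Finset V) x * homChi (∅ : Finset V) y) := by
    intro x y
    simp [hYdef, vecMulVec_apply, Matrix.sum_apply]
  have hcol0 : Y.col none = tightSum G h w U D - ε • p + c • homChi ∅ := by
    ext o
    simp [hYab, tightSum, hp, ← hT]
  have hcolv : ∀ v, Y.col (some v) = ∑ S ∈ T.filter (fun S => v ∈ S), homChi S -
      (ε * p (some v)) • p := by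
    intro v
    ext o
    simp only [col_apply, hYab, Pi.sub_apply, Finset.sum_apply, Pi.smul_apply, smul_eq_mul,
      homChi_some, mul_ite, mul_one, mul_zero, Finset.notMem_empty, if_false, add_zero]
    rw [Finset.sum_filter, mul_right_comm, mul_assoc]
  have hcolv' : ∀ v, Y.col none - Y.col (some v) =
      ∑ S ∈ T.filter (fun S => v ∉ S), homChi S - (ε * (1 - p (some v))) • p + c • homChi ∅ := by
    intro v
    rw [hcol0, hcolv, tightSum, ← hT,
      ← Finset.sum_filter_add_sum_filter_not T (fun S => v ∈ S) homChi, mul_sub, sub_smul, mul_one]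
    abel
  have hstab : ∀ (q : Finset V → Prop) [DecidablePred q], ∑ S ∈ T.filter q, homChi S ∈ lsCone G k :=
    fun q _ => sum_homChi_mem_lsCone (Finset.filter_subset _ _)
  have hchub : c • homChi ∅ ∈ lsCone G k := homCone_smul empty_homChi_mem_lsCone hc0.le
  have hlift : Y ∈ lsPlusLift (lsPlusIter (fracStab G) k) := by
    refine ⟨hpsd, ?_, fun v => ?_⟩
    · ext o
      have hsq : ∀ S : Finset V, homChi S o * homChi S o = homChi S o := by
        intro S
        cases o with
        | none => simp
        | some v => rw [homChi_some]; split_ifs <;> simp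
      simp only [col_apply, diag_apply, hYab, hsq, hp, homChi_none, mul_one]
    · by_cases hv : v ∈ D.image h
      · obtain ⟨i, hi, rfl⟩ := Finset.mem_image.1 hv
        have hpv : p (some (h i)) = 1 := by rw [hp, homChi_some, if_pos hv]
        rw [hcolv', hcolv, hpv, mul_one, sub_self, mul_zero, zero_smul, sub_zero]
        exact ⟨hC.sum_hub_sub_mem_lsCone hi (hεD i hi), homCone_add hconv (hstab _) hchub⟩
      · have hpv : p (some v) = 0 := by rw [hp, homChi_some, if_neg hv]
        rw [hcolv', hcolv, hpv, mul_zero, zero_smul, sub_zero, sub_zero, mul_one]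
        refine ⟨hstab _, homCone_add hconv ?_ hchub⟩
        by_cases hvU : v ∈ U
        · have := hεU v hvU
          rwa [tightSum, hC.tightSets_erase_vertex hvU] at this
        -- For a wing of `i`, the hub `h i` excludes it; a vertex outside the support is in no tight
        -- set. So the sum over the sets avoiding `v` includes all sets containing `h i`, and part
        -- `i` can be removed.
        · obtain ⟨i, hi, hiv⟩ : ∃ i ∈ D, ∀ S ∈ T, h i ∈ S → v ∉ S := by
            by_cases hvW : ∃ i ∈ D, ∃ a, v = w i a
            · obtain ⟨i, hi, a, rfl⟩ := hvW
              refine ⟨i, hi, fun S hS h1 h2 => ?_⟩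
              have hadj := hC.hub_adj_wing i hi a
              exact (mem_tightSets.1 hS).2.1 h1 h2 hadj.ne hadj
            · obtain ⟨i, hi⟩ := hD
              refine ⟨i, hi, fun S hS _ h2 => ?_⟩
              rcases mem_cliqueSupport.1 ((mem_tightSets.1 hS).1 h2) with h3 | ⟨j, hj, rfl | h3⟩
              · exact hvU h3
              · exact hv (Finset.mem_image_of_mem h hj)
              · exact hvW ⟨j, hj, h3⟩
          have h1 := hC.sum_hub_sub_mem_lsCone hi (hεD i hi)
          have h2 : T.filter (fun S => h i ∈ S) ⊆ T.filter (fun S => v ∉ S) := fun S hS => by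
            rw [Finset.mem_filter] at hS ⊢
            exact ⟨hS.1, hiv S hS.1 hS.2⟩
          convert homCone_add hconv h1 (sum_homChi_mem_lsCone
            (Finset.sdiff_subset.trans (Finset.filter_subset (fun S => v ∉ S) T) :
              T.filter (fun S => v ∉ S) \ T.filter (fun S => h i ∈ S) ⊆ _)) using 1
          rw [← Finset.sum_sdiff h2]
          abel
  rw [← hcol0]
  refine col_none_mem_homCone_lsPlus hlift ?_
  rw [hYab]
  obtain ⟨S, hS⟩ := hC.tightSets_nonempty hcard
  have : (1 : ℝ) ≤ T.card := by exact_mod_cast Finset.card_pos.2 ⟨S, hS⟩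
  simp only [hp, homChi_none, mul_one, Finset.sum_const, nsmul_eq_mul]
  linarith

/-- The surplus `c e₀` of the matrix is traded, modulo tight vectors, for `c (|D| + 1) p = (2ε/3)
p`. A perturbation of `-(ε/3) p` remains. -/
theorem hasGap_succ (hC : IsStretchedClique G h w U D) (hD : D.Nonempty)
    (hcard : 3 ≤ U.card + D.card)
    (hfull : ∀ j ∈ D, ∀ a, (∃ u ∈ U, ¬ G.Adj (w j a) u) ∨
      ∃ i ∈ D, i ≠ j ∧ ∀ b, ¬ G.Adj (w j a) (w i b))
    (hgU : ∀ v ∈ U, HasGap G h w (U.erase v) D k)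
    (hgD : ∀ i ∈ D, HasGap G h w U (D.erase i) k) : HasGap G h w U D (k + 1) := by
  obtain ⟨b, hb⟩ : ∃ b : Finset V → ℝ, ∑ S ∈ tightSets G h w U D, b S • homChi S =
      (D.card + 1 : ℝ) • homChi (D.image h) - homChi ∅ := by
    have := hC.hub_combination_mem_span hfull
    rw [← homChi_empty, Submodule.mem_span_image_finset_iff_exists_fun'] at this
    exact this
  obtain ⟨ε, hε, hy⟩ := hC.exists_gap_matrix hD hcard hb.symm hgU hgD
  set c := ε * (2 / (3 * (D.card + 1 : ℝ))) with hc
  have hc0 : 0 < c := by positivity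
  set B := ∑ S ∈ tightSets G h w U D, |b S| with hB
  have hB0 : 0 ≤ B := Finset.sum_nonneg fun _ _ => abs_nonneg _
  -- Scaling by `t` leaves weight `1 - t = t c B` on every tight vector, enough to outweigh the
  -- possibly negative `t c b S`.
  set t := 1 / (1 + c * B) with ht
  have ht0 : 0 < t := by positivity
  refine ⟨t * (ε / 3), by positivity, ?_⟩
  have hmem : ∑ S ∈ tightSets G h w U D, (1 - t + t * c * b S) • homChi S ∈ lsCone G (k + 1) := by
    refine homCone_sum (convex_lsPlusIter_fracStab G (k + 1)) (lsPlusIter_fracStab_nonempty G _)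
      _ _ fun S hS => homCone_smul (homChi_mem_lsCone (mem_tightSets.1 hS).2.1 _) ?_
    have h1 : |b S| ≤ B := Finset.single_le_sum (fun S _ => abs_nonneg (b S)) hS
    have h2 := neg_abs_le (b S)
    have h3 : t * (1 + c * B) = 1 := by rw [ht]; field_simp
    have h4 : t * c * (-B) ≤ t * c * b S :=
      mul_le_mul_of_nonneg_left (by linarith) (by positivity)
    linarith
  convert homCone_add (convex_lsPlusIter_fracStab G (k + 1)) (homCone_smul hy ht0.le) hmem using 1
  have h1 : ∑ S ∈ tightSets G h w U D, (1 - t + t * c * b S) • homChi S =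
      (1 - t) • tightSum G h w U D + (t * c) • ((D.card + 1 : ℝ) • homChi (D.image h) -
        homChi ∅) := by
    rw [← hb, tightSum, Finset.smul_sum, Finset.smul_sum, ← Finset.sum_add_distrib]
    exact Finset.sum_congr rfl fun S _ => by rw [add_smul, smul_smul]
  rw [h1]
  have h2 : c * (D.card + 1 : ℝ) = ε * (2 / 3) := by rw [hc]; field_simp
  ext o
  simp only [Pi.add_apply, Pi.sub_apply, Pi.smul_apply, smul_eq_mul]
  linear_combination (-t * homChi (D.image h) o) * h2

theorem card_le_three (hC : IsStretchedClique G h w U D) (hG : G.CliqueFree 4) : U.card ≤ 3 := by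
  by_contra hU
  obtain ⟨s, hs, hs4⟩ := Finset.exists_subset_card_eq (by omega : 4 ≤ U.card)
  exact hG s ⟨fun u hu v hv huv => hC.adj_of_mem u (hs hu) v (hs hv) huv, hs4⟩

/-- The inner induction on `|D|` is at a fixed level and serves the full-wing case. Removing a part
lowers `|U| + |D|` and the level together. -/
theorem hasGap (hG : G.CliqueFree 4) (k : ℕ) : ∀ (U : Finset V) (D : Finset ι),
    IsStretchedClique G h w U D → U.card + D.card = k + 3 → HasGap G h w U D k := by
  induction k with
  | zero => exact fun U D hC hcard => hC.hasGap_zero (by omega)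
  | succ k ih =>
    intro U D
    induction hd : D.card generalizing U D with
    | zero =>
      intro hC hcard
      have := hC.card_le_three hG
      omega
    | succ d ihd =>
      intro hC hcard
      by_cases hfull : ∃ j ∈ D, ∃ a, (∀ u ∈ U, G.Adj (w j a) u) ∧
          ∀ i ∈ D, i ≠ j → ∃ b, G.Adj (w j a) (w i b)
      · obtain ⟨j, hj, a, hjU, hjD⟩ := hfull
        have := Finset.card_erase_add_one hj
        refine hC.hasGap_of_full hj hjU hjD
          (ihd _ _ (by omega) (hC.of_full hj hjU hjD) ?_)
        rw [Finset.card_insert_of_notMem (hC.wing_notMem j hj a)]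
        omega
      · refine hC.hasGap_succ (Finset.card_pos.1 (by omega)) (by omega) ?_ ?_ ?_
        · intro j hj a
          by_contra hcon
          push Not at hcon
          exact hfull ⟨j, hj, a, hcon⟩
        · intro v hv
          have := Finset.card_erase_add_one hv
          exact ih _ _ (hC.mono (Finset.erase_subset _ _) subset_rfl) (by omega)
        · intro i hi
          have := Finset.card_erase_add_one hi
          exact ih _ _ (hC.mono subset_rfl (Finset.erase_subset _ _)) (by omega)

/-- Summing coordinates over the support, the gap vector has `ε |D|` less than the tight sum, while
the right side of the inequality drops by `ε (|D| + 1)`. The bound `|D| + 1` on stable sets is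
violated. -/
theorem lsPlusIter_ne_integerHull (hC : IsStretchedClique G h w U D) (hg : HasGap G h w U D k) :
    lsPlusIter (fracStab G) k ≠ integerHull (fracStab G) := by
  intro heq
  obtain ⟨ε, hε, c, hc, x, hx, h0, hv⟩ := hg
  set W := cliqueSupport h w U D with hW
  have hsum : ∀ S ⊆ W, ∑ v ∈ W, homChi S (some v) = S.card := by
    intro S hS
    simp [homChi_some, Finset.inter_eq_right.2 hS]
  have h1 : ∑ v ∈ W, (tightSum G h w U D - ε • homChi (D.image h)) (some v) =
      (tightSets G h w U D).card * (D.card + 1) - ε * (D.image h).card := by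
    simp only [Pi.sub_apply, Finset.sum_sub_distrib, Pi.smul_apply, smul_eq_mul, tightSum,
      Finset.sum_apply, ← Finset.mul_sum]
    rw [Finset.sum_comm, hsum _ image_hub_subset_cliqueSupport]
    congr 1
    rw [Finset.sum_congr rfl fun S hS => by
      rw [hsum S (mem_tightSets.1 hS).1, (mem_tightSets.1 hS).2.2]]
    simp [mul_add]
  rw [hC.image_hub_card subset_rfl, Finset.sum_congr rfl fun v _ => hv v, ← Finset.mul_sum] at h1
  have h2 : c = (tightSets G h w U D).card - ε := by
    rw [← h0]
    simp [tightSum]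
  rw [heq] at hx
  obtain ⟨S, hS, hle⟩ := exists_indep_of_mem_integerHull hx fun v => if v ∈ W then 1 else 0
  simp only [ite_mul, one_mul, zero_mul, Finset.sum_ite_mem, Finset.univ_inter, Finset.sum_const,
    nsmul_eq_mul, mul_one] at hle
  have h3 : ((S ∩ W).card : ℝ) ≤ D.card + 1 := by
    exact_mod_cast hC.card_le_of_indep (hS.mono (by simp)) (Finset.inter_subset_right : S ∩ W ⊆ W)
  have h4 := mul_le_mul_of_nonneg_left (hle.trans h3) hc
  rw [h1, h2] at h4
  nlinarith

theorem graphHasLSPlusRank (hC : IsStretchedClique G h w U D) (hG : G.CliqueFree 4) {ℓ : ℕ}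
    (hℓ : 0 < ℓ) (hcard : U.card + D.card = ℓ + 2) (hV : Fintype.card V = 3 * ℓ) :
    GraphHasLSPlusRank G ℓ := by
  have : Nonempty V := Fintype.card_pos_iff.1 (by omega)
  refine ⟨lsPlusIter_eq_integerHull (by omega), fun k hk => ?_⟩
  by_contra hlt
  refine hC.lsPlusIter_ne_integerHull (hasGap hG (ℓ - 1) U D hC (by omega))
    (Set.Subset.antisymm ?_ (integerHull_subset_lsPlusIter G _))
  have hk' : lsPlusIter (fracStab G) k = integerHull (fracStab G) := hk
  rw [← hk']
  exact lsPlusIter_fracStab_antitone G (by omega)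

end IsStretchedClique

end GapStep

/-! ### Transport along graph isomorphisms. -/

section Transport

variable {V V' ι : Type*} {G : SimpleGraph V} {G' : SimpleGraph V'}
  {h : ι → V} {w : ι → Fin 2 → V} {U : Finset V} {D : Finset ι}

theorem IsStretchedClique.map (hC : IsStretchedClique G h w U D) (f : G ≃g G') :
    IsStretchedClique G' (fun i => f (h i)) (fun i a => f (w i a))
      (U.map f.toEquiv.toEmbedding) D := by
  have hU : ∀ v, v ∈ U.map f.toEquiv.toEmbedding ↔ ∃ u ∈ U, f u = v := by
    intro v; rw [Finset.mem_map]; rfl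
  have hU' : ∀ v, f v ∈ U.map f.toEquiv.toEmbedding ↔ v ∈ U := fun v => by
    rw [hU]
    exact ⟨fun ⟨u, hu, e⟩ => f.injective e ▸ hu, fun hv => ⟨v, hv, rfl⟩⟩
  constructor
  · intro u hu v hv huv
    obtain ⟨u, huU, rfl⟩ := (hU _).1 hu
    obtain ⟨v, hvU, rfl⟩ := (hU _).1 hv
    exact f.map_adj_iff.2 (hC.adj_of_mem u huU v hvU fun e => huv (e ▸ rfl))
  · simpa [f.map_adj_iff] using hC.hub_adj_wing
  · simpa using hC.wing_ne
  · simpa [f.map_adj_iff] using hC.wing_not_adj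
  · simpa only [hU'] using hC.hub_notMem
  · simpa only [hU'] using hC.wing_notMem
  · intro i hi u hu
    obtain ⟨u, huU, rfl⟩ := (hU _).1 hu
    simpa [f.map_adj_iff] using hC.hub_not_adj i hi u huU
  · intro i hi u hu
    obtain ⟨u, huU, rfl⟩ := (hU _).1 hu
    simpa only [f.map_adj_iff] using hC.exists_wing_adj i hi u huU
  · simpa using hC.hub_ne_hub
  · simpa [f.map_adj_iff] using hC.hub_not_adj_hub
  · simpa using hC.hub_ne_wing
  · simpa [f.map_adj_iff] using hC.hub_not_adj_wing
  · simpa using hC.wing_ne_wing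
  · simpa only [f.map_adj_iff] using hC.wing_adj_wing

end Transport

/-! ### From iterated stretching to the structural description. -/

section Named

variable {n : ℕ} {V : Type*}

/-- The adjacency properties of a 2-stretched clique with named vertices, where `D` is the set of
the stretched vertices. -/
structure IsNamedClique (G : SimpleGraph V) (name : V → StretchName n) (D : Finset (Fin n)) :
    Prop where
  injective : Function.Injective name
  exists_unstretched : ∀ i ∉ D, ∃ x, name x = .unstretched i
  notMem_of_unstretched : ∀ x i, name x = .unstretched i → i ∉ D
  exists_hub : ∀ i ∈ D, ∃ x, name x = .hub i
  mem_of_hub : ∀ x i, name x = .hub i → i ∈ D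
  exists_wing : ∀ i ∈ D, ∀ a, ∃ x, name x = .wing i a
  mem_of_wing : ∀ x i a, name x = .wing i a → i ∈ D
  adj_of_unstretched : ∀ x y i j, name x = .unstretched i → name y = .unstretched j → i ≠ j →
    G.Adj x y
  hub_adj_iff : ∀ x y i, name x = .hub i → (G.Adj x y ↔ ∃ a, name y = .wing i a)
  wing_not_adj : ∀ x y i a b, name x = .wing i a → name y = .wing i b → ¬ G.Adj x y
  exists_adj_wing : ∀ x i j, name x = .unstretched j → i ∈ D →
    ∃ a y, name y = .wing i a ∧ G.Adj x y
  wing_adj_wing : ∀ i ∈ D, ∀ j ∈ D, i ≠ j →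
    ∃ a b x y, name x = .wing i a ∧ name y = .wing j b ∧ G.Adj x y

theorem isNamedClique_top :
    IsNamedClique (⊤ : SimpleGraph (Fin n)) StretchName.unstretched ∅ := by
  constructor
  case injective => intro a b e; injection e
  case exists_unstretched => exact fun i _ => ⟨i, rfl⟩
  case adj_of_unstretched =>
    intro x y i j hx hy hij
    injection hx with hx
    injection hy with hy
    subst hx hy
    exact hij
  all_goals simp

/-- Since the sets `A j` cover the neighbourhood of `v`, each former neighbour is joined to some
wing of `v`. This preserves the existence of edges between parts; hubs acquire no further
neighbours. -/
theorem IsNamedClique.stretch {G : SimpleGraph V} {name : V → StretchName n} {D : Finset (Fin n)}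
    (hN : IsNamedClique G name D) {v : V} {i : Fin n} (hv : name v = .unstretched i)
    {A : Fin 2 → Set V} (hA : ⋃ j, A j = G.neighborSet v) :
    IsNamedClique (stretchGraph G v A) (stretchNames name v i) (insert i D) := by
  have hiD := hN.notMem_of_unstretched v i hv
  have hAv : ∀ u, G.Adj v u ↔ ∃ c, u ∈ A c := by
    intro u
    rw [← SimpleGraph.mem_neighborSet, ← hA, Set.mem_iUnion]
  have hmem : ∀ {j}, j ∈ insert i D → j ≠ i → j ∈ D := fun h1 h2 =>
    (Finset.mem_insert.1 h1).resolve_left h2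
  have hsymm : ∀ {x y}, (stretchGraph G v A).Adj x y → (stretchGraph G v A).Adj y x :=
    fun h => h.symm
  have hwing : ∀ k ∈ D, ∃ (a : Fin 2) (c : Fin 2) (x : {u : V // u ≠ v} ⊕ Option (Fin 2)),
      stretchNames name v i x = .wing k a ∧
      (stretchGraph G v A).Adj (Sum.inr (some c)) x := by
    intro k hk
    obtain ⟨a, y, hy, hadj⟩ := hN.exists_adj_wing v k i hv hk
    obtain ⟨c, hc⟩ := (hAv y).1 hadj
    exact ⟨a, c, Sum.inl ⟨y, hadj.ne'⟩, hy, hc⟩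
  constructor
  case injective =>
    rintro (⟨a, ha⟩ | _ | a) (⟨b, hb⟩ | _ | b) e
    · have : a = b := hN.injective e
      subst this; rfl
    · exact absurd (hN.mem_of_hub a i e) hiD
    · exact absurd (hN.mem_of_wing a i b e) hiD
    · exact absurd (hN.mem_of_hub b i e.symm) hiD
    · rfl
    · exact absurd e (by simp [stretchNames])
    · exact absurd (hN.mem_of_wing b i a e.symm) hiD
    · exact absurd e (by simp [stretchNames])
    · have : a = b := by simpa [stretchNames] using e
      subst this; rfl
  case exists_unstretched =>
    intro j hj
    rw [Finset.mem_insert, not_or] at hj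
    obtain ⟨x, hx⟩ := hN.exists_unstretched j hj.2
    refine ⟨Sum.inl ⟨x, ?_⟩, hx⟩
    rintro rfl
    rw [hv] at hx
    injection hx with hx
    exact hj.1 hx.symm
  case notMem_of_unstretched =>
    rintro (⟨x, hxv⟩ | _ | a) j hx hj
    · rcases Finset.mem_insert.1 hj with rfl | hj
      · exact hxv (hN.injective ((show name x = _ from hx).trans hv.symm))
      · exact hN.notMem_of_unstretched x j hx hj
    · exact absurd hx (by simp [stretchNames])
    · exact absurd hx (by simp [stretchNames])
  case exists_hub =>
    intro j hj
    by_cases hji : j = i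
    · exact ⟨Sum.inr none, by rw [hji]; rfl⟩
    · obtain ⟨x, hx⟩ := hN.exists_hub j (hmem hj hji)
      refine ⟨Sum.inl ⟨x, ?_⟩, hx⟩
      rintro rfl
      simp [hv] at hx
  case mem_of_hub =>
    rintro (⟨x, hxv⟩ | _ | a) j hx
    · exact Finset.mem_insert_of_mem (hN.mem_of_hub x j hx)
    · have : i = j := by simpa [stretchNames] using hx
      simp [this]
    · exact absurd hx (by simp [stretchNames])
  case exists_wing =>
    intro j hj a
    by_cases hji : j = i
    · exact ⟨Sum.inr (some a), by rw [hji]; rfl⟩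
    · obtain ⟨x, hx⟩ := hN.exists_wing j (hmem hj hji) a
      refine ⟨Sum.inl ⟨x, ?_⟩, hx⟩
      rintro rfl
      simp [hv] at hx
  case mem_of_wing =>
    rintro (⟨x, hxv⟩ | _ | c) j a hx
    · exact Finset.mem_insert_of_mem (hN.mem_of_wing x j a hx)
    · exact absurd hx (by simp [stretchNames])
    · have : i = j := (by simpa [stretchNames] using hx : i = j ∧ c = a).1
      simp [this]
  case adj_of_unstretched =>
    rintro (⟨x, hxv⟩ | _ | c) (⟨y, hyv⟩ | _ | c') j k hx hy hjk
    · exact hN.adj_of_unstretched x y j k hx hy hjk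
    all_goals first
      | (simp [stretchNames] at hx; done)
      | simp [stretchNames] at hy
  case hub_adj_iff =>
    rintro (⟨x, hxv⟩ | _ | c) y j hx
    · have hjD := hN.mem_of_hub x j hx
      rcases y with ⟨y, hyv⟩ | _ | c'
      · exact hN.hub_adj_iff x y j hx
      · simp [stretchGraph, stretchNames]
      · constructor
        · intro hadj
          have h1 : G.Adj x v := ((hAv x).2 ⟨c', hadj⟩).symm
          obtain ⟨a, ha⟩ := (hN.hub_adj_iff x v j hx).1 h1
          simp [hv] at ha
        · rintro ⟨a, ha⟩
          have : i = j := (by simpa [stretchNames] using ha : i = j ∧ c' = a).1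
          exact absurd (this ▸ hjD) hiD
    · have hij : i = j := by simpa [stretchNames] using hx
      subst hij
      rcases y with ⟨y, hyv⟩ | _ | c'
      · constructor
        · exact fun hadj => absurd hadj (by simp [stretchGraph])
        · rintro ⟨a, ha⟩
          exact absurd (hN.mem_of_wing y i a ha) hiD
      · simp [stretchGraph, stretchNames]
      · simp [stretchGraph, stretchNames]
    · exact absurd hx (by simp [stretchNames])
  case wing_not_adj =>
    rintro (⟨x, hxv⟩ | _ | c) (⟨y, hyv⟩ | _ | c') j a b hx hy
    · exact hN.wing_not_adj x y j a b hx hy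
    · exact absurd hy (by simp [stretchNames])
    · have : i = j := (by simpa [stretchNames] using hy : i = j ∧ c' = b).1
      exact absurd (this ▸ hN.mem_of_wing x j a hx) hiD
    · exact absurd hx (by simp [stretchNames])
    · exact absurd hx (by simp [stretchNames])
    · exact absurd hx (by simp [stretchNames])
    · have : i = j := (by simpa [stretchNames] using hx : i = j ∧ c = a).1
      exact absurd (this ▸ hN.mem_of_wing y j b hy) hiD
    · exact absurd hy (by simp [stretchNames])
    · simp [stretchGraph]
  case exists_adj_wing =>
    rintro (⟨x, hxv⟩ | _ | c) k j hx hk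
    · by_cases hki : k = i
      · subst hki
        have hjk : k ≠ j := by
          rintro rfl
          exact hxv (hN.injective ((show name x = _ from hx).trans hv.symm))
        obtain ⟨c, hc⟩ := (hAv x).1 (hN.adj_of_unstretched v x k j hv hx hjk)
        exact ⟨c, Sum.inr (some c), rfl, hc⟩
      · obtain ⟨a, y, hy, hadj⟩ := hN.exists_adj_wing x k j hx (hmem hk hki)
        refine ⟨a, Sum.inl ⟨y, ?_⟩, hy, hadj⟩
        rintro rfl
        simp [hv] at hy
    · exact absurd hx (by simp [stretchNames])
    · exact absurd hx (by simp [stretchNames])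
  case wing_adj_wing =>
    intro j hj k hk hjk
    by_cases hji : j = i
    · subst hji
      obtain ⟨a, c, x, hx, hadj⟩ := hwing k (hmem hk hjk.symm)
      exact ⟨c, a, Sum.inr (some c), x, rfl, hx, hadj⟩
    by_cases hki : k = i
    · subst hki
      obtain ⟨a, c, x, hx, hadj⟩ := hwing j (hmem hj hjk)
      exact ⟨a, c, x, Sum.inr (some c), hx, rfl, hsymm hadj⟩
    obtain ⟨a, b, x, y, hx, hy, hadj⟩ := hN.wing_adj_wing j (hmem hj hji) k (hmem hk hki) hjk
    refine ⟨a, b, Sum.inl ⟨x, ?_⟩, Sum.inl ⟨y, ?_⟩, hx, hy, hadj⟩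
    · rintro rfl
      simp [hv] at hx
    · rintro rfl
      simp [hv] at hy

theorem NamedStretchedClique.exists_isNamedClique {d : ℕ} {W : Type} {H : SimpleGraph W}
    {name : W → StretchName n} (hN : NamedStretchedClique n d W H name) :
    Finite W ∧ Nat.card W = n + 2 * d ∧
      ∃ D : Finset (Fin n), D.card = d ∧ IsNamedClique H name D := by
  induction hN with
  | clique => exact ⟨inferInstance, by simp, ∅, rfl, isNamedClique_top⟩
  | @stretch d V G name hN v i hv A hA ih =>
    obtain ⟨hfin, hcard, D, hD, hND⟩ := ih
    refine ⟨inferInstance, ?_, insert i D, ?_, hND.stretch hv hA⟩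
    · classical
      have := Fintype.ofFinite V
      have hpos : 0 < Fintype.card V := Fintype.card_pos_iff.2 ⟨v⟩
      rw [Nat.card_eq_fintype_card] at hcard ⊢
      rw [Fintype.card_sum, Fintype.card_option, Fintype.card_fin, Fintype.card_subtype_compl,
        Fintype.card_subtype_eq]
      omega
    · rw [Finset.card_insert_of_notMem (hND.notMem_of_unstretched v i hv), hD]

/-- Stretching alone guarantees at least one edge between the wings of two parts; `huniq` makes it
the only one. -/
theorem IsNamedClique.exists_isStretchedClique {G : SimpleGraph V} {name : V → StretchName n}
    {D : Finset (Fin n)} (hN : IsNamedClique G name D) [Nonempty V]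
    (huniq : ∀ i ∈ D, ∀ j ∈ D, i ≠ j → ∀ x y x' y' a b a' b', name x = .wing i a →
      name y = .wing j b → G.Adj x y → name x' = .wing i a' → name y' = .wing j b' →
      G.Adj x' y' → a' = a ∧ b' = b) :
    ∃ (h : Fin n → V) (w : Fin n → Fin 2 → V) (U : Finset V),
      IsStretchedClique G h w U D ∧ U.card + D.card = n := by
  classical
  -- A dummy value for the names that do not occur, so that hubs, wings and unstretched vertices
  -- become total functions of the index.
  have v₀ : V := Classical.arbitrary V
  have hh : ∀ i, ∃ x, i ∈ D → name x = .hub i := fun i => by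
    by_cases hi : i ∈ D
    · exact (hN.exists_hub i hi).imp fun x hx _ => hx
    · exact ⟨v₀, fun h => absurd h hi⟩
  have hw : ∀ i a, ∃ x, i ∈ D → name x = .wing i a := fun i a => by
    by_cases hi : i ∈ D
    · exact (hN.exists_wing i hi a).imp fun x hx _ => hx
    · exact ⟨v₀, fun h => absurd h hi⟩
  have hu : ∀ i, ∃ x, i ∉ D → name x = .unstretched i := fun i => by
    by_cases hi : i ∈ D
    · exact ⟨v₀, fun h => absurd hi h⟩
    · exact (hN.exists_unstretched i hi).imp fun x hx _ => hx
  choose h hh using hh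
  choose w hw using hw
  choose u hu using hu
  have hU : ∀ v ∈ (Dᶜ).image u, ∃ i, i ∉ D ∧ v = u i ∧ name v = .unstretched i := by
    intro v hv
    obtain ⟨i, hi, rfl⟩ := Finset.mem_image.1 hv
    rw [Finset.mem_compl] at hi
    exact ⟨i, hi, rfl, hu i hi⟩
  have hne : ∀ {x y : V}, name x ≠ name y → x ≠ y := fun h e => h (e ▸ rfl)
  refine ⟨h, w, (Dᶜ).image u, ?_, ?_⟩
  · constructor
    · intro x hx y hy hxy
      obtain ⟨i, hi, rfl, hx⟩ := hU x hx
      obtain ⟨j, hj, rfl, hy⟩ := hU y hy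
      exact hN.adj_of_unstretched _ _ i j hx hy fun e => hxy (e ▸ rfl)
    · exact fun i hi a => (hN.hub_adj_iff _ _ i (hh i hi)).2 ⟨a, hw i a hi⟩
    · exact fun i hi => hne (by simp [hw i _ hi])
    · exact fun i hi => hN.wing_not_adj _ _ i _ _ (hw i 0 hi) (hw i 1 hi)
    · intro i hi hx
      obtain ⟨j, -, -, hx⟩ := hU _ hx
      simp [hh i hi] at hx
    · intro i hi a hx
      obtain ⟨j, -, -, hx⟩ := hU _ hx
      simp [hw i a hi] at hx
    · intro i hi x hx hadj
      obtain ⟨j, -, -, hx⟩ := hU _ hx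
      obtain ⟨a, ha⟩ := (hN.hub_adj_iff _ _ i (hh i hi)).1 hadj
      simp [hx] at ha
    · intro i hi x hx
      obtain ⟨j, -, -, hx⟩ := hU _ hx
      obtain ⟨a, y, hy, hadj⟩ := hN.exists_adj_wing x i j hx hi
      rw [hN.injective (hy.trans (hw i a hi).symm)] at hadj
      exact ⟨a, hadj.symm⟩
    · exact fun i hi j hj hij => hne (by simp [hh i hi, hh j hj, hij])
    · intro i hi j hj hadj
      obtain ⟨a, ha⟩ := (hN.hub_adj_iff _ _ i (hh i hi)).1 hadj
      simp [hh j hj] at ha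
    · exact fun i hi j hj a => hne (by simp [hh i hi, hw j a hj])
    · intro i hi j hj hij a hadj
      obtain ⟨b, hb⟩ := (hN.hub_adj_iff _ _ i (hh i hi)).1 hadj
      rw [hw j a hj] at hb
      injection hb with hb
      exact hij hb.symm
    · exact fun i hi j hj hij a b => hne (by simp [hw i a hi, hw j b hj, hij])
    · intro i hi j hj hij
      obtain ⟨a, b, x, y, hx, hy, hadj⟩ := hN.wing_adj_wing i hi j hj hij
      refine ⟨a, b, fun a' b' => ⟨fun hadj' => ?_, ?_⟩⟩
      · exact huniq i hi j hj hij x y _ _ a b a' b' hx hy hadj (hw i a' hi) (hw j b' hj) hadj'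
      · rintro ⟨rfl, rfl⟩
        rwa [hN.injective (hx.trans (hw i a' hi).symm),
          hN.injective (hy.trans (hw j b' hj).symm)] at hadj
  · rw [Finset.card_image_of_injOn, Finset.card_compl_add_card, Fintype.card_fin]
    intro i hi j hj e
    rw [Finset.mem_coe, Finset.mem_compl] at hi hj
    have := hu i hi
    rw [e, hu j hj] at this
    injection this with this
    exact this.symm

theorem wing_unique_of_ncard_wingEdges {G : SimpleGraph V} {name : V → StretchName n} {i j : Fin n}
    (hij : i ≠ j) (hcard : (wingEdges G name i j).ncard = 1) {x y x' y' : V} {a b a' b' : Fin 2}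
    (hx : name x = .wing i a) (hy : name y = .wing j b) (hxy : G.Adj x y)
    (hx' : name x' = .wing i a') (hy' : name y' = .wing j b') (hxy' : G.Adj x' y') :
    a' = a ∧ b' = b := by
  obtain ⟨e, he⟩ := Set.ncard_eq_one.1 hcard
  have h1 : s(x, y) ∈ wingEdges G name i j := ⟨hxy, x, y, a, b, hx, hy, rfl⟩
  have h2 : s(x', y') ∈ wingEdges G name i j := ⟨hxy', x', y', a', b', hx', hy', rfl⟩
  rw [he, Set.mem_singleton_iff] at h1 h2
  rcases Sym2.eq_iff.1 (h2.trans h1.symm) with ⟨rfl, rfl⟩ | ⟨rfl, rfl⟩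
  · rw [hx] at hx'
    rw [hy] at hy'
    injection hx' with _ h3
    injection hy' with _ h4
    exact ⟨h3.symm, h4.symm⟩
  · rw [hx'] at hy
    injection hy with h3
    exact absurd h3 hij

theorem isLSMinimal_of_isHatStretchedClique [Fintype V] {G : SimpleGraph V} {ℓ : ℕ} (hℓ : 0 < ℓ)
    (hG : IsHatStretchedClique (ℓ + 2) (ℓ - 1) G) (hω : G.cliqueNum ≤ 3) : IsLSMinimal ℓ G := by
  classical
  obtain ⟨W, H, name, hN, ⟨e⟩, hat⟩ := hG
  obtain ⟨hfin, hcard, D, hD, hND⟩ := hN.exists_isNamedClique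
  have hV : Fintype.card V = 3 * ℓ := by
    rw [← Nat.card_eq_fintype_card, Nat.card_congr e.toEquiv, hcard]
    omega
  have : Nonempty W := (Nat.card_pos_iff.1 (by omega : 0 < Nat.card W)).1
  obtain ⟨h, w, U, hC, hUD⟩ := hND.exists_isStretchedClique
    fun i hi j hj hij x y x' y' a b a' b' hx hy hxy hx' hy' hxy' =>
      wing_unique_of_ncard_wingEdges hij
        (hat i j hij (hND.exists_hub i hi) (hND.exists_hub j hj)) hx hy hxy hx' hy' hxy'
  have hfree : G.CliqueFree 4 := fun s hs => by
    have := hs.isClique.card_le_cliqueNum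
    rw [hs.card_eq] at this
    omega
  exact ⟨(hC.map e.symm).graphHasLSPlusRank hfree hℓ (by simpa using hUD) hV, hV⟩

end Named

/-! ### A graph on `3ℓ` vertices attaining rank `ℓ`. -/

section Example

/-- The relation underlying `alternatingStretchedClique`. -/
def alternatingRel (d : ℕ) :
    Fin 3 ⊕ (Fin d × Option (Fin 2)) → Fin 3 ⊕ (Fin d × Option (Fin 2)) → Prop
  | .inl _, .inl _ => True
  | .inl u, .inr (_, some a) => u = 0 ↔ a = 0
  | .inr (i, none), .inr (j, some _) => i = j
  | .inr (i, some a), .inr (j, some b) => i < j ∧ a = 0 ∧ b = 1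
  | _, _ => False

/-- A 2-stretched clique with three unstretched vertices and `d` stretched ones: the first wings
are adjacent to the first unstretched vertex, the second wings to the other two, and the first wing
of `i` is adjacent to the second wings of all `j > i`. -/
def alternatingStretchedClique (d : ℕ) : SimpleGraph (Fin 3 ⊕ (Fin d × Option (Fin 2))) :=
  SimpleGraph.fromRel (alternatingRel d)

theorem isStretchedClique_alternating (d : ℕ) :
    IsStretchedClique (alternatingStretchedClique d) (fun i => Sum.inr (i, none))
      (fun i a => Sum.inr (i, some a)) (Finset.univ.map Function.Embedding.inl)
      (Finset.univ : Finset (Fin d)) := by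
  constructor
  case exists_wing_adj =>
    simp only [Finset.mem_map, Finset.mem_univ, true_and, forall_exists_index]
    rintro i _ _ u rfl
    by_cases hu : u = 0
    · exact ⟨0, by simp [alternatingStretchedClique, alternatingRel, hu]⟩
    · exact ⟨1, by simp [alternatingStretchedClique, alternatingRel, hu]⟩
  case wing_adj_wing =>
    intro i _ j _ hij
    rcases lt_or_gt_of_ne hij with h | h
    · refine ⟨0, 1, fun a b => ?_⟩
      simp [alternatingStretchedClique, alternatingRel, h, h.not_gt, hij]
    · refine ⟨1, 0, fun a b => ?_⟩
      simp [alternatingStretchedClique, alternatingRel, h, h.not_gt, hij, and_comm]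
  all_goals
    simp +contextual [alternatingStretchedClique, alternatingRel, eq_comm]

theorem cliqueFree_alternating (d : ℕ) : (alternatingStretchedClique d).CliqueFree 4 := by
  -- A proper 3-colouring: `U` gets its own indices, hubs get 2, and the wings 0 and 1 get the
  -- colours 1 and 0.
  refine SimpleGraph.Colorable.cliqueFree (n := 3) ⟨SimpleGraph.Coloring.mk
    (fun v => v.elim id fun x => x.2.elim 2 fun a => if a = 0 then 1 else 0) ?_⟩ (by norm_num)
  rintro (u | ⟨i, _ | a⟩) (v | ⟨j, _ | b⟩) hadj <;>
    simp only [alternatingStretchedClique, alternatingRel, SimpleGraph.fromRel_adj] at hadj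
  · simpa using hadj
  · simp at hadj
  · fin_cases u <;> fin_cases b <;> simp_all
  · simp at hadj
  · simp at hadj
  · fin_cases b <;> simp
  · fin_cases v <;> fin_cases a <;> simp_all
  · fin_cases a <;> simp
  · fin_cases a <;> fin_cases b <;> simp_all

theorem exists_graph_hasLSPlusRank {ℓ : ℕ} (hℓ : 0 < ℓ) :
    ∃ G : SimpleGraph (Fin (3 * ℓ)), GraphHasLSPlusRank G ℓ := by
  have hcard : Fintype.card (Fin 3 ⊕ (Fin (ℓ - 1) × Option (Fin 2))) = 3 * ℓ := by
    simp
    omega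
  let e := (Fintype.equivFinOfCardEq hcard).symm
  let f := SimpleGraph.Iso.comap e (alternatingStretchedClique (ℓ - 1))
  refine ⟨(alternatingStretchedClique (ℓ - 1)).comap e,
    ((isStretchedClique_alternating (ℓ - 1)).map f.symm).graphHasLSPlusRank
      ((cliqueFree_alternating (ℓ - 1)).comap ⟨f.toCopy⟩) hℓ ?_ (by simp)⟩
  simp
  omega

end Example

theorem corollary5p1 (ℓ : ℕ) (hℓ : 0 < ℓ) :
    (∀ {V : Type*} [Fintype V] (G : SimpleGraph V),
      IsHatStretchedClique (ℓ + 2) (ℓ - 1) G → G.cliqueNum ≤ 3 → IsLSMinimal ℓ G) ∧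
    IsLeast {m : ℕ | ∃ G : SimpleGraph (Fin m), GraphHasLSPlusRank G ℓ} (3 * ℓ) := by
  refine ⟨fun G hG hω => isLSMinimal_of_isHatStretchedClique hℓ hG hω,
    exists_graph_hasLSPlusRank hℓ, ?_⟩
  rintro m ⟨G, hG⟩
  by_contra hm
  -- For `m < 3ℓ` one has `m ≤ 3 (ℓ - 1) + 2`, so `ℓ - 1` rounds already suffice.
  have h1 : ℓ ≤ ℓ - 1 := hG.2 (lsPlusIter_eq_integerHull (by rw [Fintype.card_fin]; omega))
  omega
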